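/- Let $K\in\{\mathbb R,\mathbb C\}$ and let the times $\mathbf t=(t_1,t_3,t_5,\dots)$ be real, or (if $K=\mathbb C$) complex. Let $D$ be a set of such sequences that is open along each coordinate axis (for $\mathbf t\in D$ and each odd $n$, all small changes of $t_n$ alone stay in $D$). Let $L,Q,R,S$ be constant $N\times N$ matrices over $K$ and $V\in K^N$ a constant vector with $$R=-L^{\mathsf T},\qquad S=S^{\mathsf T},\qquad Q=VV^{\mathsf T},$$ and write $\begin{pmatrix}R_n&Q_n\\S_n&L_n\end{pmatrix}=\begin{pmatrix}R&Q\\S&L\end{pmatrix}^{n}$. Let $\Phi$ be an $N\times N$ matrix-valued function on $D$ that satisfies the odd Riccati hierarchy $$\Phi_{t_n}=S_n+L_n\Phi-\Phi R_n-\Phi Q_n\Phi\qquad(n=1,3,5,\dots)$$ and is symmetric, $\Phi^{\mathsf T}=\Phi$. Then $\phi=V^{\mathsf T}\Phi V$ solves the scalar CKP hierarchy on $D$. That is: $\phi$ has on $D$ partial derivatives of all orders, independent of the order of differentiation, and there are $K$-valued functions $u_2,u_3,\dots$ with the same property such that the formal pseudodifferential operator $$\mathcal L=\partial+u_2\,\partial^{-1}+u_3\,\partial^{-2}+\cdots,\qquad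 \partial=\partial/\partial t_1,$$ satisfies on $D$ the condition $\mathcal L+\mathcal L^{*}=0$ (where $(\sum_i a_i\partial^i)^*=\sum_i(-\partial)^i a_i$) and, for all odd $n\ge1$, $$\mathcal L_{t_n}=\big[(\mathcal L^n)_{\ge0},\mathcal L\big],\qquad \phi_{t_n}=\operatorname{res}\mathcal L^n,$$ where $(\cdot)_{\ge0}$ is the differential operator part and $\operatorname{res}$ is the coefficient of $\partial^{-1}$; in particular $u_2=\phi_{t_1}$. -/

import Mathlib

/-! ## Partial derivatives with respect to the times `t₁, t₃, t₅, …`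

A point `t : ℕ → 𝕜` encodes the odd-numbered times: `t k` is the variable `t_{2k+1}`.
Functions of the times are total functions; only their values on the domain `D` matter. -/

/-- Every point of `D` can be moved a little along each single coordinate axis inside `D`.
This holds for the open sets of all the usual spaces of time sequences (finitely supported
sequences, weighted sequence spaces, the full product), and it makes every partial derivative at a
point of `D` depend only on the values in `D`. -/
def CoordOpen {𝕜 : Type*} [RCLike 𝕜] (D : Set (ℕ → 𝕜)) : Prop :=
  ∀ t ∈ D, ∀ k : ℕ, ∀ᶠ s in nhds (t k), Function.update t k s ∈ D

/-- `∂f/∂t_{2k+1}`. -/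
noncomputable def timeDeriv {𝕜 K : Type*} [RCLike 𝕜] [RCLike K] [NormedAlgebra 𝕜 K]
    (k : ℕ) (f : (ℕ → 𝕜) → K) : (ℕ → 𝕜) → K :=
  fun t => deriv (fun s : 𝕜 => f (Function.update t k s)) (t k)

/-- The iterated partial derivative along a list of time indices. -/
noncomputable def iterTimeDeriv {𝕜 K : Type*} [RCLike 𝕜] [RCLike K] [NormedAlgebra 𝕜 K] :
    List ℕ → ((ℕ → 𝕜) → K) → (ℕ → 𝕜) → K
  | [], f => f
  | k :: l, f => timeDeriv k (iterTimeDeriv l f)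

/-- On `D`, all iterated partial derivatives of `f` exist, and their order is irrelevant. -/
def TimeSmoothOn {𝕜 K : Type*} [RCLike 𝕜] [RCLike K] [NormedAlgebra 𝕜 K]
    (D : Set (ℕ → 𝕜)) (f : (ℕ → 𝕜) → K) : Prop :=
  (∀ (l : List ℕ) (k : ℕ), ∀ t ∈ D,
    DifferentiableAt 𝕜 (fun s : 𝕜 => iterTimeDeriv l f (Function.update t k s)) (t k)) ∧
  (∀ l l' : List ℕ, l.Perm l' → ∀ t ∈ D, iterTimeDeriv l f t = iterTimeDeriv l' f t)

/-! ## Formal pseudodifferential operators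

For a ring `A` with a derivation `d`, a formal pseudodifferential operator `∑ aᵢ ∂ⁱ` is given by its
coefficients `i ↦ aᵢ`, `i : ℤ`, which vanish for all large `i`. The finsums below are finite sums
for such families. -/

/-- Composition, by the generalized Leibniz rule `∂ⁱ b = ∑ₖ (i choose k) d^k(b) ∂^{i-k}`. The pair
`(i, k)` contributes `(i choose k) aᵢ d^k(bⱼ) ∂^{i+j-k}`, and `i + j - k = n`. -/
noncomputable def psiMul {A : Type*} [CommRing A] (d : A → A) (P Q : ℤ → A) : ℤ → A :=
  fun n => ∑ᶠ p : ℤ × ℕ, Ring.choose p.1 p.2 • (P p.1 * d^[p.2] (Q (n - p.1 + p.2)))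

/-- The identity operator. -/
def psiOne {A : Type*} [CommRing A] : ℤ → A := fun n => if n = 0 then 1 else 0

/-- Powers of an operator. -/
noncomputable def psiPow {A : Type*} [CommRing A] (d : A → A) (P : ℤ → A) : ℕ → ℤ → A
  | 0 => psiOne
  | n + 1 => psiMul d (psiPow d P n) P

/-- The formal adjoint `(∑ aᵢ ∂ⁱ)^* = ∑ (-∂)ⁱ aᵢ`. The coefficient of `∂ⁿ` receives
`(-1)^{n+k} (n+k choose k) d^k(a_{n+k})` from `i = n + k`. -/
noncomputable def psiAdjoint {A : Type*} [CommRing A] (d : A → A) (P : ℤ → A) : ℤ → A :=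
  fun n => ∑ᶠ k : ℕ,
    (((n + k).negOnePow : ℤ) * Ring.choose (n + k) k) • d^[k] (P (n + k))

/-- The differential operator part `(P)_{≥ 0}`. -/
def psiNonneg {A : Type*} [CommRing A] (P : ℤ → A) : ℤ → A :=
  fun n => if 0 ≤ n then P n else 0

/-- The residue, i.e. the coefficient of `∂⁻¹`. -/
def psiRes {A : Type*} (P : ℤ → A) : A := P (-1)

/-- The Lax operator `∂ + u₂ ∂⁻¹ + u₃ ∂⁻² + …` (only the `u j` with `2 ≤ j` enter). -/
def laxOperator {A : Type*} [CommRing A] (u : ℕ → A) : ℤ → A :=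
  fun i => if i = 1 then 1 else if i < 0 then u (1 - i).toNat else 0

/-! ## The scalar CKP hierarchy -/

/-- `φ` solves the scalar CKP hierarchy on `D`: there is a Lax operator
`L = ∂ + u₂ ∂⁻¹ + u₃ ∂⁻² + …`, `∂ = ∂/∂t₁`, with smooth coefficients, such that
`L + L^* = 0`, `L_{t_n} = [(Lⁿ)_{≥ 0}, L]` for all odd `n`, and `φ` is its potential, that is,
`φ_{t_n} = res Lⁿ` for all odd `n` (for `n = 1` this says `u₂ = φ_{t₁}`). -/
def IsCKPSolution {𝕜 K : Type*} [RCLike 𝕜] [RCLike K] [NormedAlgebra 𝕜 K]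
    (D : Set (ℕ → 𝕜)) (φ : (ℕ → 𝕜) → K) : Prop :=
  TimeSmoothOn D φ ∧
  ∃ u : ℕ → (ℕ → 𝕜) → K,
    let L : ℤ → (ℕ → 𝕜) → K := laxOperator u
    let d : ((ℕ → 𝕜) → K) → (ℕ → 𝕜) → K := timeDeriv 0
    (∀ j, TimeSmoothOn D (u j)) ∧
    (∀ i : ℤ, ∀ t ∈ D, L i t + psiAdjoint d L i t = 0) ∧
    (∀ k : ℕ, ∀ i : ℤ, ∀ t ∈ D,
      timeDeriv k (L i) t =
        psiMul d (psiNonneg (psiPow d L (2 * k + 1))) L i t -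
          psiMul d L (psiNonneg (psiPow d L (2 * k + 1))) i t) ∧
    (∀ k : ℕ, ∀ t ∈ D, timeDeriv k φ t = psiRes (psiPow d L (2 * k + 1)) t)

/-! ## The odd Riccati hierarchy -/

/-- `Φ_{t_n} = S_n + L_n Φ - Φ R_n - Φ Q_n Φ` on `D` for all odd `n`, where `R_n, Q_n, S_n, L_n` are
the blocks of the `n`-th power of the block matrix `(R Q; S L)`. -/
def IsOddRiccatiSolution {𝕜 K : Type*} [RCLike 𝕜] [RCLike K] [NormedAlgebra 𝕜 K]
    {M N : ℕ} (R : Matrix (Fin N) (Fin N) K) (Q : Matrix (Fin N) (Fin M) K)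
    (S : Matrix (Fin M) (Fin N) K) (L : Matrix (Fin M) (Fin M) K)
    (D : Set (ℕ → 𝕜)) (Φ : (ℕ → 𝕜) → Matrix (Fin M) (Fin N) K) : Prop :=
  ∀ t ∈ D, ∀ k : ℕ, ∀ i j,
    let Hn := Matrix.fromBlocks R Q S L ^ (2 * k + 1)
    HasDerivAt (fun s : 𝕜 => Φ (Function.update t k s) i j)
      ((Hn.toBlocks₂₁ + Hn.toBlocks₂₂ * Φ t - Φ t * Hn.toBlocks₁₁
        - Φ t * Hn.toBlocks₁₂ * Φ t) i j) (t k)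

/-! Put `H = (R Q; S L)` and let `(uᵢ; gᵢ) = Hⁱ (1; Φ)` (`upperFlow`, `lowerFlow`). The Riccati
equations say that the subspace spanned by the columns of `(1; Φ)` moves under the powers of `H`.
Since `Q = V Vᵀ` has rank one, they collapse to scalar recursions for the moments `c i m = Vᵀ gᵢ Rᵐ
V` (`flowMoment_succ` for `t₁`, `flowMoment_eq` for the other times). These are the equations of a
point of the Sato Grassmannian in affine coordinates: call an operator `P` admissible if `P_{-m-1} =
-∑_{i ≥ 0} Pᵢ c i m` for all `m`. The recursion in `t₁` makes the admissible operators a left module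
over the differential operators, and `W = 1 - ∑ₘ c 0 m ∂^{-m-1}` is admissible. The recursion in
`tₙ` makes `W_{tₙ} + W ∂ⁿ` admissible as well. An admissible operator of order at most `-1`
vanishes, so `W_{tₙ} + W ∂ⁿ = B W` with a differential operator `B` (`exists_sato`). The Lax
equations for `𝓛 = W ∂ W⁻¹` and `res 𝓛ⁿ = ∂(c 0 0)/∂tₙ = φ_{tₙ}` follow formally.

The reduction `𝓛 + 𝓛* = 0` rests on `W = 1 - VᵀΦ(∂ - R)⁻¹V`. Symmetry of `Φ` and `R = -Lᵀ` give `W*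
= 1 + Vᵀ(∂ - L)⁻¹ΦV`, and the Riccati equation in `t₁` turns the product into `W*W = 1 - Vᵀ(∂ -
L)⁻¹S(∂ - R)⁻¹V`. This has constant coefficients, hence commutes with `∂`, which makes `𝓛` skew
(`lax_add_adj_eq_zero`).

Functions on `D` with `timeDeriv` do not form a differential ring, so the algebra takes place in the
polynomial ring on the entries of a generic symmetric matrix, with the Riccati flows as commuting
derivations. Odd powers of `H` are Hamiltonian, so these flows preserve symmetry. Evaluation at `Φ
t` intertwines the derivations with the time derivatives and carries every identity to `D`;
smoothness comes along, since each coefficient is a polynomial in the entries of `Φ`. -/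

/-! ### Combinatorics of the Leibniz rule: regrouped sums and binomial identities. -/

-- Leibniz expansions replace an index `k` by the pair of numbers of derivatives falling on the two
-- factors; this lemma exchanges the two ways of indexing. Finiteness is required of the unfolded
-- family, because inner sums could vanish by cancellation.
open Function Finset in
theorem finsum_sum_antidiagonal {X A : Type*} [AddCommMonoid A] (G : X → ℕ × ℕ → A)
    (hG : HasFiniteSupport fun p : X × (ℕ × ℕ) => G p.1 p.2) :
    ∑ᶠ p : X × ℕ, ∑ q ∈ HasAntidiagonal.antidiagonal p.2, G p.1 q = ∑ᶠ p : X × (ℕ × ℕ), G p.1 p.2 := by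
  classical
  set s := hG.toFinset with hs
  let f : X × (ℕ × ℕ) → X × ℕ := fun p => (p.1, p.2.1 + p.2.2)
  have hmem : ∀ p : X × (ℕ × ℕ), G p.1 p.2 ≠ 0 → p ∈ s := fun p hp => by
    exact (Set.Finite.mem_toFinset (hs := hG)).2 hp
  rw [finsum_eq_sum_of_support_subset (s := s)]
  swap
  · intro p hp; exact hmem p hp
  rw [finsum_eq_sum_of_support_subset (s := s.image f)]
  swap
  · intro p hp
    obtain ⟨q, hq, hne⟩ := Finset.exists_ne_zero_of_sum_ne_zero hp
    rw [coe_image]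
    refine ⟨(p.1, q), hmem _ hne, ?_⟩
    rw [HasAntidiagonal.mem_antidiagonal] at hq
    exact Prod.ext rfl hq
  rw [← sum_fiberwise_of_maps_to (s := s) (t := s.image f) (g := f)
    (fun x hx => mem_image_of_mem f hx)]
  refine sum_congr rfl fun p _ => ?_
  refine Finset.sum_bij_ne_zero (fun q _ _ => (p.1, q)) ?_ ?_ ?_ ?_
  · intro q hq hne
    rw [mem_filter]
    rw [HasAntidiagonal.mem_antidiagonal] at hq
    exact ⟨hmem _ hne, Prod.ext rfl hq⟩
  · intro q _ _ q' _ _ h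
    exact (Prod.ext_iff.1 h).2
  · rintro ⟨x, q⟩ hx hne
    rw [mem_filter] at hx
    have h1 : x = p.1 := congrArg Prod.fst hx.2
    have h2 : q.1 + q.2 = p.2 := congrArg Prod.snd hx.2
    subst h1
    exact ⟨q, HasAntidiagonal.mem_antidiagonal.2 h2, hne, rfl⟩
  · intro q _ _; rfl

section Leibniz

variable {A : Type*} [CommRing A] (d : Derivation ℤ A A)

/-- The iterate of a derivation as an additive map. -/
def Derivation.iter (k : ℕ) : A →+ A := ((d : A →ₗ[ℤ] A) ^ k).toAddMonoidHom

theorem Derivation.iter_apply (k : ℕ) (a : A) : d.iter k a = (⇑d)^[k] a := by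
  simp [Derivation.iter, Module.End.pow_apply]

theorem Derivation.iter_zero (a : A) : d.iter 0 a = a := by simp [d.iter_apply]

theorem Derivation.iter_iter (k l : ℕ) (a : A) : d.iter k (d.iter l a) = d.iter (k + l) a := by
  simp only [d.iter_apply, Function.iterate_add_apply]

theorem Derivation.iter_succ (k : ℕ) (a : A) : d.iter (k + 1) a = d (d.iter k a) := by
  simp only [d.iter_apply, Function.iterate_succ_apply']

theorem Derivation.iter_mul (k : ℕ) (a b : A) :
    d.iter k (a * b) =
      ∑ q ∈ Finset.HasAntidiagonal.antidiagonal k, k.choose q.1 • (d.iter q.1 a * d.iter q.2 b) := by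
  induction k with
  | zero => simp [d.iter_zero]
  | succ n ih =>
    rw [Finset.sum_antidiagonal_choose_succ_nsmul (fun i j => d.iter i a * d.iter j b) n,
      d.iter_succ, ih, map_sum, ← Finset.sum_add_distrib]
    refine Finset.sum_congr rfl fun q hq => ?_
    rw [map_nsmul, d.leibniz, d.iter_succ, d.iter_succ, smul_eq_mul, smul_eq_mul,
      Nat.choose_symm_of_eq_add (Finset.HasAntidiagonal.mem_antidiagonal.1 hq).symm, ← smul_add,
      mul_comm (d.iter q.2 b)]

end Leibniz

section Binomial

theorem Ring.choose_mul_natChoose (x : ℤ) (s a : ℕ) :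
    Ring.choose x (s + a) * ((s + a).choose s : ℤ) = Ring.choose x s * Ring.choose (x - s) a := by
  have h := Ring.choose_smul_choose x (Nat.le_add_right s a)
  rw [Nat.add_sub_cancel_left, nsmul_eq_mul] at h
  rw [mul_comm, h]

theorem Ring.sum_choose_antidiagonal (x y : ℤ) (r : ℕ) :
    ∑ q ∈ Finset.HasAntidiagonal.antidiagonal r, Ring.choose x q.1 * Ring.choose y q.2 = Ring.choose (x + y) r :=
  (Ring.add_choose_eq r (Commute.all x y)).symm

theorem Ring.choose_neg_sub_one (x : ℤ) (a : ℕ) :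
    Ring.choose (-x - 1) a = (a : ℤ).negOnePow * Ring.choose (x + a) a := by
  have h := Ring.choose_neg (x + 1) a
  rw [show -(x + 1) = -x - 1 by ring, show x + 1 + (a : ℤ) - 1 = x + a by ring] at h
  rw [h]; simp [Units.smul_def, Int.coe_negOnePow_natCast]

/-- The coefficient identity behind `(PQ)^* = Q^* P^*`. -/
theorem Ring.sum_negOnePow_choose (n i : ℤ) (s r : ℕ) :
    ∑ q ∈ Finset.HasAntidiagonal.antidiagonal r, ((n + (s + q.1 : ℕ)).negOnePow : ℤ) *
      Ring.choose (n + (s + q.1 : ℕ)) (s + q.1) * ((s + q.1).choose s : ℤ) * Ring.choose i q.2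
    = ((n + s + r).negOnePow : ℤ) * Ring.choose (n + s) s * Ring.choose (n + s + r - i) r := by
  have h1 : ∀ q ∈ Finset.HasAntidiagonal.antidiagonal r, ((n + (s + q.1 : ℕ)).negOnePow : ℤ) *
      Ring.choose (n + (s + q.1 : ℕ)) (s + q.1) * ((s + q.1).choose s : ℤ) * Ring.choose i q.2
      = ((n + s).negOnePow : ℤ) * Ring.choose (n + s) s *
        (Ring.choose (-(n + s) - 1) q.1 * Ring.choose i q.2) := by
    intro q _
    rw [Ring.choose_neg_sub_one, mul_assoc _ (Ring.choose (n + (s + q.1 : ℕ)) (s + q.1))]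
    have e : Ring.choose (n + (s + q.1 : ℕ)) (s + q.1) * ((s + q.1).choose s : ℤ)
        = Ring.choose (n + s) s * Ring.choose (n + s + q.1) q.1 := by
      have := Ring.choose_mul_natChoose (n + (s + q.1 : ℕ)) q.1 s
      rw [add_comm q.1 s] at this
      rw [Nat.choose_symm_add, this]
      push_cast
      rw [show n + (s + q.1 : ℤ) - q.1 = n + s by ring, ← add_assoc, mul_comm]
    rw [e]
    push_cast
    rw [← add_assoc, Int.negOnePow_add (n + s) (q.1 : ℤ)]
    push_cast
    ring
  rw [Finset.sum_congr rfl h1, ← Finset.mul_sum, Ring.sum_choose_antidiagonal]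
  have h2 := Ring.choose_neg_sub_one (n + s - i) r
  rw [show -(n + s) - 1 + i = -(n + s - i) - 1 by ring, h2, Int.negOnePow_add (n + s) (r : ℤ),
    show n + s - i + (r : ℤ) = n + s + r - i by ring]
  push_cast
  ring

end Binomial

/-! ### Composition of symbols and its associativity. -/

/-- The symbol `P` has order at most `b`. -/
def PsiOrderLE {A : Type*} [Zero A] (b : ℤ) (P : ℤ → A) : Prop := ∀ i, b < i → P i = 0

theorem PsiOrderLE.le_of_ne_zero {A : Type*} [Zero A] {b : ℤ} {P : ℤ → A} (h : PsiOrderLE b P)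
    {i : ℤ} (hi : P i ≠ 0) : i ≤ b := not_lt.1 fun hlt => hi (h i hlt)

theorem PsiOrderLE.mono {A : Type*} [Zero A] {b c : ℤ} {P : ℤ → A} (h : PsiOrderLE b P)
    (hbc : b ≤ c) : PsiOrderLE c P := fun i hi => h i (hbc.trans_lt hi)

section Finiteness

theorem finite_mul_index (n a b : ℤ) :
    {p : ℤ × ℕ | p.1 ≤ a ∧ n - p.1 + p.2 ≤ b}.Finite := by
  refine (Finset.finite_toSet (Finset.Icc (n - b) a ×ˢ Finset.range (a + b - n).toNat.succ)).subset
    fun p hp => ?_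
  simp only [Set.mem_ofPred_eq, Finset.coe_product, Set.mem_prod, Finset.coe_Icc, Set.mem_Icc,
    Finset.coe_range, Set.mem_Iio] at hp ⊢
  omega

theorem finite_mul_mul_index (n a b c : ℤ) :
    {p : (ℤ × ℕ) × (ℤ × ℕ) | p.1.1 ≤ a ∧ p.2.1 ≤ b ∧
      n - p.1.1 + p.1.2 - p.2.1 + p.2.2 ≤ c}.Finite := by
  refine (Finset.finite_toSet
    ((Finset.Icc (n - b - c) a ×ˢ Finset.range (a + b + c - n).toNat.succ) ×ˢ
      (Finset.Icc (n - a - c) b ×ˢ Finset.range (a + b + c - n).toNat.succ))).subset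
    fun p hp => ?_
  simp only [Set.mem_ofPred_eq, Finset.coe_product, Set.mem_prod, Finset.coe_Icc, Set.mem_Icc,
    Finset.coe_range, Set.mem_Iio] at hp ⊢
  omega

end Finiteness

section Symbols

open Function Finset.HasAntidiagonal

variable {A : Type*} [CommRing A] (d : Derivation ℤ A A)

theorem psiMul_apply (P Q : ℤ → A) (n : ℤ) :
    psiMul d P Q n =
      ∑ᶠ p : ℤ × ℕ, Ring.choose p.1 p.2 • (P p.1 * d.iter p.2 (Q (n - p.1 + p.2))) := by
  simp only [psiMul, d.iter_apply]

theorem psiMul_term_le {a b : ℤ} {P Q : ℤ → A} (hP : PsiOrderLE a P) (hQ : PsiOrderLE b Q)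
    {i j : ℤ} {k : ℕ} {c : ℤ} (h : c • (P i * d.iter k (Q j)) ≠ 0) : i ≤ a ∧ j ≤ b := by
  constructor
  · refine hP.le_of_ne_zero fun h0 => h ?_
    rw [h0, zero_mul, smul_zero]
  · refine hQ.le_of_ne_zero fun h0 => h ?_
    rw [h0, map_zero, mul_zero, smul_zero]

theorem psiMul_finite {a b : ℤ} {P Q : ℤ → A} (hP : PsiOrderLE a P) (hQ : PsiOrderLE b Q)
    (n : ℤ) : HasFiniteSupport fun p : ℤ × ℕ =>
      Ring.choose p.1 p.2 • (P p.1 * d.iter p.2 (Q (n - p.1 + p.2))) :=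
  (finite_mul_index n a b).subset fun _ hp => psiMul_term_le d hP hQ hp

theorem PsiOrderLE.psiMul {a b : ℤ} {P Q : ℤ → A} (hP : PsiOrderLE a P) (hQ : PsiOrderLE b Q) :
    PsiOrderLE (a + b) (psiMul d P Q) := by
  intro n hn
  rw [psiMul_apply]
  refine finsum_eq_zero_of_forall_eq_zero fun p => ?_
  by_contra h
  have := psiMul_term_le d hP hQ h
  omega

/-- The leading coefficient is multiplicative. -/
theorem psiMul_leading {a b : ℤ} {P Q : ℤ → A} (hP : PsiOrderLE a P) (hQ : PsiOrderLE b Q) :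
    psiMul d P Q (a + b) = P a * Q b := by
  rw [psiMul_apply, finsum_eq_single _ ((a, 0) : ℤ × ℕ)]
  · simp [d.iter_zero]
  · rintro ⟨i, k⟩ hne
    by_contra h
    have := psiMul_term_le d hP hQ h
    simp only at this
    exact hne (Prod.ext (by simp only; omega) (by simp only; omega))

theorem psiMul_add {a b : ℤ} {P Q Q' : ℤ → A} (hP : PsiOrderLE a P) (hQ : PsiOrderLE b Q)
    (hQ' : PsiOrderLE b Q') : psiMul d P (Q + Q') = psiMul d P Q + psiMul d P Q' := by
  ext n
  rw [Pi.add_apply, psiMul_apply, psiMul_apply, psiMul_apply,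
    ← finsum_add_distrib (psiMul_finite d hP hQ n) (psiMul_finite d hP hQ' n)]
  simp only [Pi.add_apply, map_add, mul_add, smul_add]

theorem add_psiMul {a b : ℤ} {P P' Q : ℤ → A} (hP : PsiOrderLE a P) (hP' : PsiOrderLE a P')
    (hQ : PsiOrderLE b Q) : psiMul d (P + P') Q = psiMul d P Q + psiMul d P' Q := by
  ext n
  rw [Pi.add_apply, psiMul_apply, psiMul_apply, psiMul_apply,
    ← finsum_add_distrib (psiMul_finite d hP hQ n) (psiMul_finite d hP' hQ n)]
  simp only [Pi.add_apply, add_mul, smul_add]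

theorem psiMul_zero (P : ℤ → A) : psiMul d P 0 = 0 := by
  ext n; simp [psiMul_apply]

theorem zero_psiMul (P : ℤ → A) : psiMul d 0 P = 0 := by
  ext n; simp [psiMul_apply]

theorem psiMul_psiOne (P : ℤ → A) : psiMul d P psiOne = P := by
  ext n
  rw [psiMul_apply, finsum_eq_single _ ((n, 0) : ℤ × ℕ)]
  · simp [psiOne, d.iter_zero]
  · rintro ⟨i, k⟩ hne
    rcases k with _ | k
    · have : n - i ≠ 0 := fun h => hne (Prod.ext (by simp only; omega) rfl)
      simp [psiOne, d.iter_zero, this]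
    · have : d (psiOne (n - i + ((k + 1 : ℕ) : ℤ))) = 0 := by
        unfold psiOne; split_ifs <;> simp
      have h2 : d.iter (k + 1) (psiOne (n - i + ((k + 1 : ℕ) : ℤ))) = 0 := by
        rw [← d.iter_iter k 1, show d.iter 1 _ = 0 from by simpa [d.iter_apply] using this,
          map_zero]
      simp only at *
      rw [h2, mul_zero, smul_zero]

theorem psiOne_psiMul (P : ℤ → A) : psiMul d psiOne P = P := by
  ext n
  rw [psiMul_apply, finsum_eq_single _ ((0, 0) : ℤ × ℕ)]
  · simp [psiOne, d.iter_zero]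
  · rintro ⟨i, k⟩ hne
    by_cases hi : i = 0
    · subst hi
      have hk : 0 < k := Nat.pos_of_ne_zero fun h => hne (by rw [h])
      simp only
      rw [Ring.choose_zero_pos ℤ hk, zero_smul]
    · simp [psiOne, hi]

/-- Both sides reduce to one sum over the index `i` of `P`, the index `j` of `Q`, and the numbers
`s`, `r` of derivatives falling on `Q` and `R`. The left side has this form after reindexing. On the
right, `r` splits into derivatives produced by `∂ⁱ` and by `∂ʲ`, and Vandermonde sums over the
splittings. -/
theorem psiMul_assoc {a b c : ℤ} {P Q R : ℤ → A} (hP : PsiOrderLE a P) (hQ : PsiOrderLE b Q)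
    (hR : PsiOrderLE c R) : psiMul d (psiMul d P Q) R = psiMul d P (psiMul d Q R) := by
  ext n
  -- the common value, summed over `((i, s, j), r)`
  let T : (ℤ × ℕ × ℤ) × ℕ → A := fun x =>
    (Ring.choose x.1.1 x.1.2.1 * Ring.choose (x.1.1 - x.1.2.1 + x.1.2.2) x.2) •
      (P x.1.1 * d.iter x.1.2.1 (Q x.1.2.2) *
        d.iter x.2 (R (n - x.1.1 + x.1.2.1 - x.1.2.2 + x.2)))
  trans ∑ᶠ x, T x
  · let F : (ℤ × ℕ) × (ℤ × ℕ) → A := fun p =>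
      Ring.choose p.1.1 p.1.2 • ((Ring.choose p.2.1 p.2.2 •
        (P p.2.1 * d.iter p.2.2 (Q (p.1.1 - p.2.1 + p.2.2)))) * d.iter p.1.2 (R (n - p.1.1 + p.1.2)))
    let e : (ℤ × ℕ) × (ℤ × ℕ) ≃ (ℤ × ℕ × ℤ) × ℕ :=
      { toFun := fun p => ((p.2.1, p.2.2, p.1.1 - p.2.1 + p.2.2), p.1.2)
        invFun := fun x => ((x.1.1 - x.1.2.1 + x.1.2.2, x.2), (x.1.1, x.1.2.1))
        left_inv := by
          rintro ⟨⟨m, l⟩, ⟨i, k⟩⟩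
          simp only [Prod.mk.injEq, and_true]; ring
        right_inv := by
          rintro ⟨⟨i, s, j⟩, r⟩
          simp only [Prod.mk.injEq, and_true, true_and]; ring }
    have hF : HasFiniteSupport F := by
      refine ((finite_mul_mul_index n a b c).preimage
        (f := fun p : (ℤ × ℕ) × (ℤ × ℕ) => ((p.2.1, p.2.2), (p.1.1 - p.2.1 + p.2.2, p.1.2)))
        ?_).subset ?_
      · rintro ⟨⟨m, l⟩, ⟨i, k⟩⟩ _ ⟨⟨m', l'⟩, ⟨i', k'⟩⟩ _ h
        simp only [Prod.mk.injEq] at h ⊢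
        omega
      · rintro ⟨⟨m, l⟩, ⟨i, k⟩⟩ h
        have h1 : P i ≠ 0 := fun h0 => h (by simp [F, h0])
        have h2 : Q (m - i + k) ≠ 0 := fun h0 => h (by simp [F, h0])
        have h3 : R (n - m + l) ≠ 0 := fun h0 => h (by simp [F, h0])
        have h1 := hP.le_of_ne_zero h1
        have h2 := hQ.le_of_ne_zero h2
        have h3 := hR.le_of_ne_zero h3
        simp only [Set.mem_preimage, Set.mem_ofPred_eq]
        omega
    rw [psiMul_apply, ← finsum_comp_equiv e, finsum_congr (g := F), finsum_curry F hF]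
    · refine finsum_congr fun p => ?_
      rw [psiMul_apply]
      have := ((DistribSMul.toAddMonoidHom A (Ring.choose p.1 p.2)).comp
        (AddMonoidHom.mulRight (d.iter p.2 (R (n - p.1 + p.2))))).map_finsum
        (psiMul_finite d hP hQ p.1)
      exact this
    · rintro ⟨⟨m, l⟩, ⟨i, k⟩⟩
      simp only [T, F, e, Equiv.coe_fn_mk, smul_mul_assoc, smul_smul]
      rw [show i - (k : ℤ) + (m - i + k) = m by ring,
        show n - i + (k : ℤ) - (m - i + k) + l = n - m + l by ring, mul_comm (Ring.choose i k)]
  · let G : (ℤ × ℤ × ℕ) → ℕ × ℕ → A := fun x q =>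
      (Ring.choose x.1 (q.1 + q.2) * ((q.1 + q.2).choose q.1 : ℤ) * Ring.choose x.2.1 x.2.2) •
        (P x.1 * d.iter q.1 (Q x.2.1) *
          d.iter (q.2 + x.2.2) (R (n - x.1 + (q.1 + q.2 : ℕ) - x.2.1 + x.2.2)))
    let F : (ℤ × ℕ) × (ℤ × ℕ) → A := fun p =>
      Ring.choose p.1.1 p.1.2 • (P p.1.1 * d.iter p.1.2 (Ring.choose p.2.1 p.2.2 •
        (Q p.2.1 * d.iter p.2.2 (R (n - p.1.1 + p.1.2 - p.2.1 + p.2.2)))))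
    have hF : HasFiniteSupport F := by
      refine (finite_mul_mul_index n a b c).subset ?_
      rintro ⟨⟨i, k⟩, ⟨j, l⟩⟩ h
      have h1 : P i ≠ 0 := fun h0 => h (by simp [F, h0])
      have h2 : Q j ≠ 0 := fun h0 => h (by simp [F, h0])
      have h3 : R (n - i + k - j + l) ≠ 0 := fun h0 => h (by simp [F, h0])
      exact ⟨hP.le_of_ne_zero h1, hQ.le_of_ne_zero h2, hR.le_of_ne_zero h3⟩
    have hFG : ∀ p, F p = ∑ q ∈ antidiagonal p.1.2, G (p.1.1, p.2.1, p.2.2) q := by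
      rintro ⟨⟨i, k⟩, ⟨j, l⟩⟩
      simp only [F, G, map_zsmul, d.iter_mul, Finset.mul_sum, Finset.smul_sum]
      refine Finset.sum_congr rfl fun q hq => ?_
      rw [Finset.HasAntidiagonal.mem_antidiagonal] at hq
      subst hq
      rw [d.iter_iter]
      simp only [zsmul_eq_mul, nsmul_eq_mul]
      push_cast
      ring
    have hG : HasFiniteSupport fun p : (ℤ × ℤ × ℕ) × (ℕ × ℕ) => G p.1 p.2 := by
      refine (Finset.finite_toSet ((Finset.Icc (n - b - c) a ×ˢ Finset.Icc (n - a - c) b ×ˢ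
        Finset.range (a + b + c - n).toNat.succ) ×ˢ (Finset.range (a + b + c - n).toNat.succ ×ˢ
        Finset.range (a + b + c - n).toNat.succ))).subset ?_
      rintro ⟨⟨i, j, l⟩, ⟨s, t⟩⟩ h
      have h1 : P i ≠ 0 := fun h0 => h (by simp [G, h0])
      have h2 : Q j ≠ 0 := fun h0 => h (by simp [G, h0])
      have h3 : R (n - i + (s + t : ℕ) - j + l) ≠ 0 := fun h0 =>
        h (by simp only [G, h0, map_zero, mul_zero, smul_zero])
      have h1 := hP.le_of_ne_zero h1
      have h2 := hQ.le_of_ne_zero h2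
      have h3 := hR.le_of_ne_zero h3
      simp only [Finset.coe_product, Set.mem_prod, Finset.coe_Icc, Set.mem_Icc,
        Finset.coe_range, Set.mem_Iio]
      push_cast at h3
      omega
    -- The family `G` with `s` now held fixed; the inner pair splits `r` into the derivatives coming
    -- from `∂ⁱ` and those coming from `∂ʲ`.
    let G' : (ℤ × ℕ × ℤ) → ℕ × ℕ → A := fun x q => G (x.1, x.2.2, q.2) (x.2.1, q.1)
    let e : (ℤ × ℕ × ℤ) × (ℕ × ℕ) ≃ (ℤ × ℤ × ℕ) × (ℕ × ℕ) :=
      { toFun := fun p => ((p.1.1, p.1.2.2, p.2.2), (p.1.2.1, p.2.1))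
        invFun := fun p => ((p.1.1, p.2.1, p.1.2.1), (p.2.2, p.1.2.2))
        left_inv := fun _ => rfl
        right_inv := fun _ => rfl }
    let e' : (ℤ × ℤ × ℕ) × ℕ ≃ (ℤ × ℕ) × (ℤ × ℕ) :=
      { toFun := fun p => ((p.1.1, p.2), (p.1.2.1, p.1.2.2))
        invFun := fun p => ((p.1.1, p.2.1, p.2.2), p.1.2)
        left_inv := fun _ => rfl
        right_inv := fun _ => rfl }
    have hG' : HasFiniteSupport fun p : (ℤ × ℕ × ℤ) × (ℕ × ℕ) => G' p.1 p.2 :=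
      hG.preimage (f := e) e.injective.injOn
    have hT : ∀ x, T x = ∑ q ∈ antidiagonal x.2, G' x.1 q := by
      rintro ⟨⟨i, s, j⟩, r⟩
      simp only [T, G', G]
      rw [← Ring.sum_choose_antidiagonal, Finset.mul_sum, Finset.sum_smul]
      refine Finset.sum_congr rfl fun q hq => ?_
      rw [Finset.HasAntidiagonal.mem_antidiagonal] at hq
      subst hq
      rw [Ring.choose_mul_natChoose]
      rw [show n - i + (s : ℤ) - j + ((q.1 + q.2 : ℕ) : ℤ) = n - i + (s + q.1 : ℕ) - j + q.2 by
        push_cast; ring, mul_assoc (Ring.choose i s)]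
    rw [psiMul_apply, finsum_congr hT, finsum_sum_antidiagonal G' hG',
      show ∑ᶠ p : (ℤ × ℕ × ℤ) × (ℕ × ℕ), G' p.1 p.2 =
          ∑ᶠ p : (ℤ × ℤ × ℕ) × (ℕ × ℕ), G p.1 p.2 from
        finsum_comp_equiv e (f := fun p => G p.1 p.2), ← finsum_sum_antidiagonal G hG,
      show ∑ᶠ p : (ℤ × ℤ × ℕ) × ℕ, ∑ q ∈ antidiagonal p.2, G p.1 q = ∑ᶠ p, F (e' p) from
        finsum_congr fun p => (hFG (e' p)).symm, finsum_comp_equiv e', finsum_curry F hF]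
    refine finsum_congr fun p => ?_
    rw [psiMul_apply]
    have := ((DistribSMul.toAddMonoidHom A (Ring.choose p.1 p.2)).comp
      ((AddMonoidHom.mulLeft (P p.1)).comp (d.iter p.2))).map_finsum
      (psiMul_finite d hQ hR (n - p.1 + p.2))
    exact this.symm

end Symbols

/-! ### The formal adjoint as an anti-automorphism. -/

section Adjoint

open Function Finset.HasAntidiagonal

variable {A : Type*} [CommRing A] (d : Derivation ℤ A A)

theorem psiAdjoint_apply (P : ℤ → A) (n : ℤ) :
    psiAdjoint d P n =
      ∑ᶠ k : ℕ, (((n + k).negOnePow : ℤ) * Ring.choose (n + k) k) • d.iter k (P (n + k)) := by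
  simp only [psiAdjoint, d.iter_apply]

theorem psiAdjoint_finite {a : ℤ} {P : ℤ → A} (hP : PsiOrderLE a P) (n : ℤ) :
    HasFiniteSupport fun k : ℕ =>
      (((n + k).negOnePow : ℤ) * Ring.choose (n + k) k) • d.iter k (P (n + k)) := by
  refine (Set.finite_Iio (a - n).toNat.succ).subset fun k hk => ?_
  have h : P (n + k) ≠ 0 := fun h0 => hk (by simp only [h0, map_zero, smul_zero])
  have := hP.le_of_ne_zero h
  rw [Set.mem_Iio]
  omega

theorem PsiOrderLE.psiAdjoint {a : ℤ} {P : ℤ → A} (hP : PsiOrderLE a P) :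
    PsiOrderLE a (psiAdjoint d P) := by
  intro n hn
  rw [psiAdjoint_apply]
  refine finsum_eq_zero_of_forall_eq_zero fun k => ?_
  rw [hP _ (by omega), map_zero, smul_zero]

theorem psiAdjoint_add {a : ℤ} {P Q : ℤ → A} (hP : PsiOrderLE a P) (hQ : PsiOrderLE a Q) :
    psiAdjoint d (P + Q) = psiAdjoint d P + psiAdjoint d Q := by
  ext n
  rw [Pi.add_apply, psiAdjoint_apply, psiAdjoint_apply, psiAdjoint_apply,
    ← finsum_add_distrib (psiAdjoint_finite d hP n) (psiAdjoint_finite d hQ n)]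
  simp only [Pi.add_apply, map_add, smul_add]

/-- On symbols with constant coefficients the adjoint only changes signs. -/
theorem psiAdjoint_apply_of_const {P : ℤ → A} (hP : ∀ i, d (P i) = 0) (n : ℤ) :
    psiAdjoint d P n = (n.negOnePow : ℤ) • P n := by
  rw [psiAdjoint_apply, finsum_eq_single _ 0]
  · simp [d.iter_zero]
  · intro k hk
    obtain ⟨k, rfl⟩ := Nat.exists_eq_succ_of_ne_zero hk
    have : d.iter 1 (P (n + (k.succ : ℕ))) = 0 := by simpa [d.iter_apply] using hP _
    rw [Nat.succ_eq_add_one, ← d.iter_iter k 1, this, map_zero, smul_zero]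

/-- The adjoint of multiplication by a function. -/
theorem psiAdjoint_single_zero (a : A) :
    psiAdjoint d (Pi.single 0 a) = Pi.single 0 a := by
  ext n
  rw [psiAdjoint_apply, finsum_eq_single _ 0]
  · by_cases h : n = 0
    · subst h; simp [d.iter_zero]
    · simp [d.iter_zero, h]
  · intro k hk
    by_cases h : n + (k : ℤ) = 0
    · rw [h, Ring.choose_zero_pos ℤ (Nat.pos_of_ne_zero hk), mul_zero, zero_smul]
    · rw [Pi.single_eq_of_ne h, map_zero, smul_zero]

/-- Again both sides are compared with one sum, over the index `i` of `P` and the numbers `s`, `r`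
of derivatives on `P` and `Q`. The left side needs the alternating identity
`Ring.sum_negOnePow_choose`; the right side only Vandermonde, over the ways in which `s` arises from
the adjoint of `P` and from the composition. -/
theorem psiAdjoint_psiMul {a b : ℤ} {P Q : ℤ → A} (hP : PsiOrderLE a P) (hQ : PsiOrderLE b Q) :
    psiAdjoint d (psiMul d P Q) = psiMul d (psiAdjoint d Q) (psiAdjoint d P) := by
  ext n
  -- the common value, summed over `((i, s), r)`
  let T : (ℤ × ℕ) × ℕ → A := fun x =>
    (((n + x.1.2 + x.2).negOnePow : ℤ) * Ring.choose (n + x.1.2) x.1.2 *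
      Ring.choose (n + x.1.2 + x.2 - x.1.1) x.2) •
      (d.iter x.1.2 (P x.1.1) * d.iter x.2 (Q (n + x.1.2 + x.2 - x.1.1)))
  have hb : ∀ {i : ℤ} {s r : ℕ}, P i ≠ 0 → Q (n + s + r - i) ≠ 0 →
      i ∈ Set.Icc (n - b) a ∧ s < (a + b - n).toNat.succ ∧ r < (a + b - n).toNat.succ := by
    intro i s r h1 h2
    have h1 := hP.le_of_ne_zero h1
    have h2 := hQ.le_of_ne_zero h2
    rw [Set.mem_Icc]
    omega
  trans ∑ᶠ x, T x
  · let G : (ℤ × ℕ) → ℕ × ℕ → A := fun x q =>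
      (((n + (q.1 + q.2 : ℕ)).negOnePow : ℤ) * Ring.choose (n + (q.1 + q.2 : ℕ)) (q.1 + q.2) *
        ((q.1 + q.2).choose q.1 : ℤ) * Ring.choose x.1 x.2) •
        (d.iter q.1 (P x.1) * d.iter (q.2 + x.2) (Q (n + (q.1 + q.2 : ℕ) - x.1 + x.2)))
    let F : ℕ × (ℤ × ℕ) → A := fun p =>
      (((n + p.1).negOnePow : ℤ) * Ring.choose (n + p.1) p.1) • d.iter p.1
        (Ring.choose p.2.1 p.2.2 • (P p.2.1 * d.iter p.2.2 (Q (n + p.1 - p.2.1 + p.2.2))))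
    have hF : HasFiniteSupport F := by
      refine (Finset.finite_toSet (Finset.range (a + b - n).toNat.succ ×ˢ
        Finset.Icc (n - b) a ×ˢ Finset.range (a + b - n).toNat.succ)).subset ?_
      rintro ⟨k, i, l⟩ h
      have h1 : P i ≠ 0 := fun h0 => h (by simp [F, h0])
      have h2 : Q (n + k + l - i) ≠ 0 := fun h0 => h (by
        rw [show n + (k : ℤ) + l - i = n + k - i + l by ring] at h0
        simp [F, h0])
      have := hb h1 h2
      simpa [and_left_comm] using this
    have hFG : ∀ p, F p = ∑ q ∈ antidiagonal p.1, G p.2 q := by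
      rintro ⟨k, i, l⟩
      simp only [F, G, map_zsmul, d.iter_mul, Finset.smul_sum]
      refine Finset.sum_congr rfl fun q hq => ?_
      rw [Finset.HasAntidiagonal.mem_antidiagonal] at hq
      subst hq
      rw [d.iter_iter]
      simp only [zsmul_eq_mul, nsmul_eq_mul]
      push_cast
      ring
    have hG : HasFiniteSupport fun p : (ℤ × ℕ) × (ℕ × ℕ) => G p.1 p.2 := by
      refine (Finset.finite_toSet ((Finset.Icc (n - b) a ×ˢ Finset.range (a + b - n).toNat.succ) ×ˢ
        Finset.range (a + b - n).toNat.succ ×ˢ Finset.range (a + b - n).toNat.succ)).subset ?_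
      rintro ⟨⟨i, l⟩, ⟨s, t⟩⟩ h
      have h1 : P i ≠ 0 := fun h0 => h (by simp [G, h0])
      have h2 : Q (n + s + (t + l : ℕ) - i) ≠ 0 := fun h0 => h (by
        rw [show n + (s : ℤ) + (t + l : ℕ) - i = n + (s + t : ℕ) - i + l by push_cast; ring] at h0
        simp only [G, h0, map_zero, mul_zero, smul_zero])
      have := hb h1 h2
      rw [Set.mem_Icc] at this
      simp only [Finset.coe_product, Set.mem_prod, Finset.coe_Icc, Set.mem_Icc,
        Finset.coe_range, Set.mem_Iio]
      omega
    let G' : (ℤ × ℕ) → ℕ × ℕ → A := fun x q => G (x.1, q.2) (x.2, q.1)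
    let e : (ℤ × ℕ) × (ℕ × ℕ) ≃ (ℤ × ℕ) × (ℕ × ℕ) :=
      { toFun := fun p => ((p.1.1, p.2.2), (p.1.2, p.2.1))
        invFun := fun p => ((p.1.1, p.2.1), (p.2.2, p.1.2))
        left_inv := fun _ => rfl
        right_inv := fun _ => rfl }
    have hG' : HasFiniteSupport fun p : (ℤ × ℕ) × (ℕ × ℕ) => G' p.1 p.2 :=
      hG.preimage (f := e) e.injective.injOn
    have hT : ∀ x, T x = ∑ q ∈ antidiagonal x.2, G' x.1 q := by
      rintro ⟨⟨i, s⟩, r⟩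
      simp only [T, G', G]
      rw [← Ring.sum_negOnePow_choose, Finset.sum_smul]
      refine Finset.sum_congr rfl fun q hq => ?_
      rw [Finset.HasAntidiagonal.mem_antidiagonal] at hq
      subst hq
      rw [show n + (s : ℤ) + ((q.1 + q.2 : ℕ) : ℤ) - i = n + (s + q.1 : ℕ) - i + q.2 by
        push_cast; ring]
    rw [psiAdjoint_apply, finsum_congr hT, finsum_sum_antidiagonal G' hG',
      show ∑ᶠ p : (ℤ × ℕ) × (ℕ × ℕ), G' p.1 p.2 = ∑ᶠ p : (ℤ × ℕ) × (ℕ × ℕ), G p.1 p.2 from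
        finsum_comp_equiv e (f := fun p => G p.1 p.2), ← finsum_sum_antidiagonal G hG,
      show ∑ᶠ p : (ℤ × ℕ) × ℕ, ∑ q ∈ antidiagonal p.2, G p.1 q =
        ∑ᶠ p, F (Equiv.prodComm _ _ p) from finsum_congr fun p => (hFG (p.2, p.1)).symm,
      finsum_comp_equiv (Equiv.prodComm _ _), finsum_curry F hF]
    refine finsum_congr fun k => ?_
    rw [psiMul_apply]
    exact ((DistribSMul.toAddMonoidHom A (((n + k).negOnePow : ℤ) * Ring.choose (n + k) k)).comp
      (d.iter k)).map_finsum (psiMul_finite d hP hQ (n + k))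
  · let H : (ℤ × ℕ) → ℕ × ℕ → A := fun x q =>
      (((n + (q.1 + q.2 : ℕ) + x.2).negOnePow : ℤ) *
        Ring.choose (n + (q.1 + q.2 : ℕ) + x.2 - x.1) x.2 *
        (Ring.choose (n + (q.1 + q.2 : ℕ) - x.1) q.1 * Ring.choose x.1 q.2)) •
        (d.iter (q.1 + q.2) (P x.1) * d.iter x.2 (Q (n + (q.1 + q.2 : ℕ) + x.2 - x.1)))
    let F : (ℤ × ℕ) × ℕ × ℕ → A := fun p =>
      Ring.choose p.1.1 p.1.2 •
        (((((p.1.1 + p.2.1).negOnePow : ℤ) * Ring.choose (p.1.1 + p.2.1) p.2.1) •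
          d.iter p.2.1 (Q (p.1.1 + p.2.1))) *
        d.iter p.1.2 ((((n - p.1.1 + p.1.2 + p.2.2).negOnePow : ℤ) *
          Ring.choose (n - p.1.1 + p.1.2 + p.2.2) p.2.2) •
          d.iter p.2.2 (P (n - p.1.1 + p.1.2 + p.2.2))))
    let e : (ℤ × ℕ) × ℕ × ℕ ≃ (ℤ × ℕ) × (ℕ × ℕ) :=
      { toFun := fun p => ((n - p.1.1 + p.1.2 + p.2.2, p.2.1), (p.1.2, p.2.2))
        invFun := fun x => ((n - x.1.1 + x.2.1 + x.2.2, x.2.1), (x.1.2, x.2.2))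
        left_inv := by
          rintro ⟨⟨m, l⟩, r, p⟩
          simp only [Prod.mk.injEq, and_true]; ring
        right_inv := by
          rintro ⟨⟨i, r⟩, l, p⟩
          simp only [Prod.mk.injEq, and_true]; ring }
    have hFH : ∀ p, F p = H (e p).1 (e p).2 := by
      rintro ⟨⟨m, l⟩, r, p⟩
      simp only [F, H, e, Equiv.coe_fn_mk, map_zsmul, d.iter_iter]
      rw [show n + ((l + p : ℕ) : ℤ) + r - (n - m + l + p) = m + r by push_cast; ring,
        show n + ((l + p : ℕ) : ℤ) - (n - m + l + p) = m by push_cast; ring,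
        show n + ((l + p : ℕ) : ℤ) + r = (m + r) + (n - m + l + p) by push_cast; ring,
        Int.negOnePow_add (m + r)]
      simp only [zsmul_eq_mul]
      push_cast
      ring
    have hH : HasFiniteSupport fun p : (ℤ × ℕ) × (ℕ × ℕ) => H p.1 p.2 := by
      refine (Finset.finite_toSet ((Finset.Icc (n - b) a ×ˢ Finset.range (a + b - n).toNat.succ) ×ˢ
        Finset.range (a + b - n).toNat.succ ×ˢ Finset.range (a + b - n).toNat.succ)).subset ?_
      rintro ⟨⟨i, r⟩, ⟨l, p⟩⟩ h
      have h1 : P i ≠ 0 := fun h0 => h (by simp [H, h0])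
      have h2 : Q (n + (l + p : ℕ) + r - i) ≠ 0 := fun h0 => h (by
        simp only [H, h0, map_zero, mul_zero, smul_zero])
      have := hb h1 h2
      rw [Set.mem_Icc] at this
      simp only [Finset.coe_product, Set.mem_prod, Finset.coe_Icc, Set.mem_Icc,
        Finset.coe_range, Set.mem_Iio]
      omega
    have hF : HasFiniteSupport F := by
      refine (hH.preimage (f := e) e.injective.injOn).subset fun p hp => ?_
      rw [Function.mem_support, hFH] at hp
      exact hp
    let H' : (ℤ × ℕ) × ℕ → A := fun x => ∑ q ∈ antidiagonal x.2, H x.1 q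
    let e' : (ℤ × ℕ) × ℕ ≃ (ℤ × ℕ) × ℕ :=
      { toFun := fun x => ((x.1.1, x.2), x.1.2)
        invFun := fun x => ((x.1.1, x.2), x.1.2)
        left_inv := fun _ => rfl
        right_inv := fun _ => rfl }
    have hT : ∀ x, T x = H' (e' x) := by
      rintro ⟨⟨i, s⟩, r⟩
      simp only [T, H', H, e', Equiv.coe_fn_mk]
      have hs : ∀ q ∈ antidiagonal s, H (i, r) q =
          ((((n + s + r).negOnePow : ℤ) * Ring.choose (n + s + r - i) r) *
            (Ring.choose (n + s - i) q.1 * Ring.choose i q.2)) •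
            (d.iter s (P i) * d.iter r (Q (n + s + r - i))) := by
        intro q hq
        rw [Finset.HasAntidiagonal.mem_antidiagonal] at hq
        subst hq
        rfl
      rw [Finset.sum_congr rfl hs, ← Finset.sum_smul, ← Finset.mul_sum,
        Ring.sum_choose_antidiagonal, sub_add_cancel]
      congr 1
      ring
    rw [psiMul_apply, finsum_congr hT, finsum_comp_equiv e',
      finsum_sum_antidiagonal H hH, ← finsum_comp_equiv e, finsum_congr fun p => (hFH p).symm,
      finsum_curry F hF]
    refine finsum_congr fun p => ?_
    rw [psiAdjoint_apply, psiAdjoint_apply,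
      finsum_curry (fun q : ℕ × ℕ => F (p, q)) (hF.preimage (Prod.mk_right_injective p).injOn)]
    have h1 := ((DistribSMul.toAddMonoidHom A (Ring.choose p.1 p.2)).comp
      (AddMonoidHom.mulRight (d.iter p.2 (∑ᶠ k : ℕ,
        (((n - p.1 + p.2 + k).negOnePow : ℤ) * Ring.choose (n - p.1 + p.2 + k) k) •
          d.iter k (P (n - p.1 + p.2 + k)))))).map_finsum
      (psiAdjoint_finite d hQ p.1)
    refine Eq.trans ?_ h1.symm
    refine finsum_congr fun k => ?_
    exact (((DistribSMul.toAddMonoidHom A (Ring.choose p.1 p.2)).comp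
      ((AddMonoidHom.mulLeft ((((p.1 + k).negOnePow : ℤ) * Ring.choose (p.1 + k) k) •
          d.iter k (Q (p.1 + k)))).comp (d.iter p.2))).map_finsum
      (psiAdjoint_finite d hP (n - p.1 + p.2))).symm

end Adjoint

/-! ### The ring of formal pseudodifferential operators. -/

/-- The symbols of bounded order. -/
def psiBounded (A : Type*) [CommRing A] : AddSubgroup (ℤ → A) where
  carrier := {P | ∃ b, PsiOrderLE b P}
  zero_mem' := ⟨0, fun _ _ => rfl⟩
  add_mem' := by
    rintro P Q ⟨a, ha⟩ ⟨b, hb⟩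
    refine ⟨max a b, fun i hi => ?_⟩
    rw [Pi.add_apply, ha i ((le_max_left a b).trans_lt hi),
      hb i ((le_max_right a b).trans_lt hi), add_zero]
  neg_mem' := by
    rintro P ⟨a, ha⟩
    exact ⟨a, fun i hi => by rw [Pi.neg_apply, ha i hi, neg_zero]⟩

/-- The ring of formal pseudodifferential operators over the differential ring `(A, d)`. -/
def PsiDO {A : Type*} [CommRing A] (_d : Derivation ℤ A A) : Type _ := psiBounded A

namespace PsiDO

variable {A : Type*} [CommRing A] {d : Derivation ℤ A A}

/-- The coefficients of a pseudodifferential operator. -/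
def coeff (P : PsiDO d) : ℤ → A := Subtype.val P

/-- The operator with the given coefficients. -/
def mk (P : ℤ → A) (h : ∃ b, PsiOrderLE b P) : PsiDO d := ⟨P, h⟩

@[simp] theorem coeff_mk (P : ℤ → A) (h : ∃ b, PsiOrderLE b P) :
    (mk P h : PsiDO d).coeff = P := rfl

theorem exists_order (P : PsiDO d) : ∃ b, PsiOrderLE b P.coeff := P.2

theorem coeff_injective : Function.Injective (coeff : PsiDO d → ℤ → A) := Subtype.val_injective

@[ext] theorem ext {P Q : PsiDO d} (h : ∀ i, P.coeff i = Q.coeff i) : P = Q :=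
  coeff_injective (funext h)

instance : AddCommGroup (PsiDO d) := inferInstanceAs (AddCommGroup (psiBounded A))

@[simp] theorem coeff_zero : (0 : PsiDO d).coeff = 0 := rfl
@[simp] theorem coeff_add (P Q : PsiDO d) : (P + Q).coeff = P.coeff + Q.coeff := rfl
@[simp] theorem coeff_neg (P : PsiDO d) : (-P).coeff = -P.coeff := rfl
@[simp] theorem coeff_sub (P Q : PsiDO d) : (P - Q).coeff = P.coeff - Q.coeff := rfl

/-- Taking coefficients, as an additive map. -/
def coeffHom (i : ℤ) : PsiDO d →+ A where
  toFun P := P.coeff i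
  map_zero' := rfl
  map_add' _ _ := rfl

theorem coeff_sum {ι : Type*} (s : Finset ι) (f : ι → PsiDO d) (i : ℤ) :
    (∑ x ∈ s, f x).coeff i = ∑ x ∈ s, (f x).coeff i := map_sum (coeffHom i) f s

instance : One (PsiDO d) := ⟨mk psiOne ⟨0, fun i hi => by simp [psiOne, hi.ne']⟩⟩

noncomputable instance : Mul (PsiDO d) :=
  ⟨fun P Q => mk (psiMul d P.coeff Q.coeff) <| by
    obtain ⟨a, ha⟩ := P.exists_order
    obtain ⟨b, hb⟩ := Q.exists_order
    exact ⟨a + b, ha.psiMul d hb⟩⟩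

theorem coeff_one : (1 : PsiDO d).coeff = psiOne := rfl
theorem coeff_mul (P Q : PsiDO d) : (P * Q).coeff = psiMul d P.coeff Q.coeff := rfl

noncomputable instance : Ring (PsiDO d) :=
  { (inferInstance : AddCommGroup (PsiDO d)), (inferInstance : One (PsiDO d)),
    (inferInstance : Mul (PsiDO d)) with
    left_distrib := fun P Q R => coeff_injective <| by
      obtain ⟨a, ha⟩ := P.exists_order
      obtain ⟨b, hb⟩ := Q.exists_order
      obtain ⟨c, hc⟩ := R.exists_order
      exact psiMul_add d ha (hb.mono (le_max_left b c)) (hc.mono (le_max_right b c))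
    right_distrib := fun P Q R => coeff_injective <| by
      obtain ⟨a, ha⟩ := P.exists_order
      obtain ⟨b, hb⟩ := Q.exists_order
      obtain ⟨c, hc⟩ := R.exists_order
      exact add_psiMul d (ha.mono (le_max_left a b)) (hb.mono (le_max_right a b)) hc
    zero_mul := fun P => coeff_injective (zero_psiMul d P.coeff)
    mul_zero := fun P => coeff_injective (psiMul_zero d P.coeff)
    one_mul := fun P => coeff_injective (psiOne_psiMul d P.coeff)
    mul_one := fun P => coeff_injective (psiMul_psiOne d P.coeff)
    mul_assoc := fun P Q R => coeff_injective <| by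
      obtain ⟨a, ha⟩ := P.exists_order
      obtain ⟨b, hb⟩ := Q.exists_order
      obtain ⟨c, hc⟩ := R.exists_order
      exact psiMul_assoc d ha hb hc }

theorem coeff_pow (P : PsiDO d) (n : ℕ) : (P ^ n).coeff = psiPow d P.coeff n := by
  induction n with
  | zero => rw [pow_zero]; rfl
  | succ n ih => rw [pow_succ, coeff_mul, ih]; rfl

/-! ### Order -/

/-- `P` has order at most `b`. -/
def OrderLE (b : ℤ) (P : PsiDO d) : Prop := PsiOrderLE b P.coeff

theorem OrderLE.mono {a b : ℤ} {P : PsiDO d} (h : P.OrderLE a) (hab : a ≤ b) : P.OrderLE b :=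
  PsiOrderLE.mono h hab

theorem OrderLE.mul {a b : ℤ} {P Q : PsiDO d} (hP : P.OrderLE a) (hQ : Q.OrderLE b) :
    (P * Q).OrderLE (a + b) := PsiOrderLE.psiMul d hP hQ

theorem OrderLE.add {a : ℤ} {P Q : PsiDO d} (hP : P.OrderLE a) (hQ : Q.OrderLE a) :
    (P + Q).OrderLE a := fun i hi => by
  rw [coeff_add, Pi.add_apply, hP i hi, hQ i hi, add_zero]

theorem OrderLE.neg {a : ℤ} {P : PsiDO d} (hP : P.OrderLE a) : (-P).OrderLE a := fun i hi => by
  rw [coeff_neg, Pi.neg_apply, hP i hi, neg_zero]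

theorem OrderLE.sub {a : ℤ} {P Q : PsiDO d} (hP : P.OrderLE a) (hQ : Q.OrderLE a) :
    (P - Q).OrderLE a := sub_eq_add_neg P Q ▸ hP.add hQ.neg

theorem orderLE_one : (1 : PsiDO d).OrderLE 0 := fun i hi => by
  rw [coeff_one]; simp [psiOne, hi.ne']

theorem OrderLE.pow {P : PsiDO d} {a : ℤ} (hP : P.OrderLE a) (k : ℕ) :
    (P ^ k).OrderLE ((k : ℤ) * a) := by
  induction k with
  | zero => simpa using orderLE_one
  | succ k ih =>
    rw [pow_succ]
    refine (ih.mul hP).mono (le_of_eq ?_)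
    push_cast; ring

theorem coeff_mul_leading {a b : ℤ} {P Q : PsiDO d} (hP : P.OrderLE a) (hQ : Q.OrderLE b) :
    (P * Q).coeff (a + b) = P.coeff a * Q.coeff b := psiMul_leading d hP hQ

/-- An operator `1 + (order ≤ -1)` is invertible. -/
theorem isUnit_of_order_sub_one {W : PsiDO d} (hW : (1 - W).OrderLE (-1)) :
    ∃ X : PsiDO d, X * W = 1 ∧ W * X = 1 ∧ (1 - X).OrderLE (-1) := by
  set Z : PsiDO d := 1 - W with hZ
  have hpow : ∀ k : ℕ, (Z ^ k).OrderLE (-k) := fun k => (hW.pow k).mono (by ring_nf; rfl)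
  let S : ℕ → PsiDO d := fun K => ∑ k ∈ Finset.range K, Z ^ k
  have hS : ∀ (K M : ℕ) (i : ℤ), K ≤ M → -(K : ℤ) < i → (S M).coeff i = (S K).coeff i := by
    intro K M i hKM hi
    simp only [S, coeff_sum]
    rw [← Finset.sum_range_add_sum_Ico _ hKM, Finset.sum_eq_zero (s := Finset.Ico K M), add_zero]
    intro k hk
    rw [Finset.mem_Ico] at hk
    exact hpow k i (by omega)
  -- The Neumann series of `W⁻¹`. Since `Z ^ k` has order at most `-k`, the coefficient at `i`
  -- involves only `k ≤ -i`, so a partial sum already gives it.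
  let X : PsiDO d := mk (fun i => (S ((-i).toNat + 1)).coeff i) ⟨0, fun i hi => by
    have : (-i).toNat = 0 := by omega
    simp only [this]
    simp only [S, zero_add, Finset.sum_range_one, pow_zero]
    exact orderLE_one i hi⟩
  have hX : ∀ K : ℕ, (X - S K).OrderLE (-K) := by
    intro K i hi
    rw [coeff_sub, Pi.sub_apply, sub_eq_zero]
    change (S ((-i).toNat + 1)).coeff i = _
    rcases le_total K ((-i).toNat + 1) with h | h
    · exact hS _ _ i h hi
    · exact (hS _ _ i h (by omega)).symm
  have hW0 : W.OrderLE 0 := by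
    have : W = 1 - Z := by rw [hZ]; abel
    rw [this]
    exact orderLE_one.sub (hW.mono (by norm_num))
  have hSW : ∀ K, S K * W = 1 - Z ^ K := fun K => by
    rw [show W = 1 - Z by rw [hZ]; abel]
    exact geom_sum_mul_neg Z K
  have hWS : ∀ K, W * S K = 1 - Z ^ K := fun K => by
    rw [show W = 1 - Z by rw [hZ]; abel]
    exact mul_neg_geom_sum Z K
  -- The order filtration is separated; both inverse identities can thus be checked modulo every
  -- order `-K`.
  have hzero : ∀ Y : PsiDO d, (∀ K : ℕ, Y.OrderLE (-K)) → Y = 0 := fun Y hY => by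
    ext i
    exact hY ((-i).toNat + 1) i (by push_cast; omega)
  refine ⟨X, ?_, ?_, ?_⟩
  · rw [← sub_eq_zero]
    refine hzero _ fun K => ?_
    have : X * W - 1 = (X - S K) * W - Z ^ K := by rw [sub_mul, hSW]; abel
    rw [this]
    exact (((hX K).mul hW0).mono (by simp)).sub (hpow K)
  · rw [← sub_eq_zero]
    refine hzero _ fun K => ?_
    have : W * X - 1 = W * (X - S K) - Z ^ K := by rw [mul_sub, hWS]; abel
    rw [this]
    exact ((hW0.mul (hX K)).mono (by simp)).sub (hpow K)
  · have := (hX 1).neg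
    simpa [S, neg_sub] using this

/-! ### Functions and the derivative as operators -/

/-- Multiplication by a function. -/
noncomputable def fn (a : A) : PsiDO d :=
  mk (Pi.single 0 a) ⟨0, fun _ hi => Pi.single_eq_of_ne (M := fun _ => A) hi.ne' a⟩

/-- The operator `∂ⁿ`. -/
noncomputable def del (n : ℤ) : PsiDO d :=
  mk (Pi.single n 1) ⟨n, fun _ hi => Pi.single_eq_of_ne (M := fun _ => A) hi.ne' 1⟩

theorem coeff_fn (a : A) : (fn a : PsiDO d).coeff = Pi.single 0 a := rfl
theorem coeff_del (n : ℤ) : (del n : PsiDO d).coeff = Pi.single n 1 := rfl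

theorem fn_mul_coeff (a : A) (P : PsiDO d) (n : ℤ) : (fn a * P).coeff n = a * P.coeff n := by
  rw [coeff_mul, psiMul_apply, finsum_eq_single _ ((0, 0) : ℤ × ℕ)]
  · simp [coeff_fn, d.iter_zero]
  · rintro ⟨i, k⟩ hne
    by_cases hi : i = 0
    · subst hi
      have hk : 0 < k := Nat.pos_of_ne_zero fun h => hne (by rw [h])
      simp only
      rw [Ring.choose_zero_pos ℤ hk, zero_smul]
    · simp [coeff_fn, hi]

theorem mul_del_coeff (P : PsiDO d) (m n : ℤ) : (P * del m).coeff n = P.coeff (n - m) := by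
  rw [coeff_mul, psiMul_apply, finsum_eq_single _ ((n - m, 0) : ℤ × ℕ)]
  · simp [coeff_del, d.iter_zero]
  · rintro ⟨i, k⟩ hne
    rcases k with _ | k
    · have : n - i ≠ m := fun h => hne (Prod.ext (by simp only; omega) rfl)
      simp [coeff_del, d.iter_zero, this]
    · have h1 : d ((Pi.single m 1 : ℤ → A) (n - i + ((k + 1 : ℕ) : ℤ))) = 0 := by
        rw [Pi.single_apply]; split_ifs <;> simp
      have h2 : d.iter (k + 1) ((Pi.single m 1 : ℤ → A) (n - i + ((k + 1 : ℕ) : ℤ))) = 0 := by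
        rw [← d.iter_iter k 1, show d.iter 1 _ = 0 from by simpa [d.iter_apply] using h1,
          map_zero]
      simp only at *
      rw [coeff_del, h2, mul_zero, smul_zero]

theorem del_one_mul_coeff (P : PsiDO d) (n : ℤ) :
    (del 1 * P).coeff n = d (P.coeff n) + P.coeff (n - 1) := by
  rw [coeff_mul, psiMul_apply,
    finsum_eq_sum_of_support_subset (s := {((1, 0) : ℤ × ℕ), ((1, 1) : ℤ × ℕ)})]
  · rw [Finset.sum_pair (by simp)]
    simp [coeff_del, d.iter_apply, add_comm]
  · rintro ⟨i, k⟩ h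
    by_cases hi : i = 1
    · subst hi
      have hk : k < 2 := by
        by_contra hk
        refine h ?_
        have : Ring.choose (1 : ℤ) k = 0 := by
          have := Ring.choose_natCast (R := ℤ) 1 k
          rw [Nat.cast_one] at this
          rw [this, Nat.choose_eq_zero_of_lt (by omega), Nat.cast_zero]
        simp only [this, zero_smul]
      interval_cases k <;> simp
    · exact absurd (by simp [coeff_del, hi]) h

theorem coeff_del_mul_of_const {P : PsiDO d} (hP : ∀ i, d (P.coeff i) = 0) (m n : ℤ) :
    (del m * P).coeff n = P.coeff (n - m) := by
  rw [coeff_mul, psiMul_apply, finsum_eq_single _ ((m, 0) : ℤ × ℕ)]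
  · simp [coeff_del, d.iter_zero]
  · rintro ⟨i, k⟩ hne
    by_cases hi : i = m
    · subst hi
      have hk : k ≠ 0 := fun h => hne (by rw [h])
      obtain ⟨k, rfl⟩ := Nat.exists_eq_succ_of_ne_zero hk
      have : d.iter 1 (P.coeff (n - i + (k.succ : ℕ))) = 0 := by simpa [d.iter_apply] using hP _
      simp only
      rw [Nat.succ_eq_add_one, ← d.iter_iter k 1, this, map_zero, mul_zero, smul_zero]
    · simp [coeff_del, hi]

theorem del_mul_del (m n : ℤ) : (del m * del n : PsiDO d) = del (m + n) := by
  ext i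
  rw [mul_del_coeff, coeff_del, coeff_del, Pi.single_apply, Pi.single_apply]
  congr 1
  simp only [eq_iff_iff]; omega

theorem del_zero : (del 0 : PsiDO d) = 1 := by
  ext i
  simp [coeff_del, coeff_one, psiOne, Pi.single_apply]

theorem del_one_pow (n : ℕ) : (del 1 : PsiDO d) ^ n = del n := by
  induction n with
  | zero => simp [del_zero]
  | succ n ih => rw [pow_succ, ih, del_mul_del]; push_cast; rfl

theorem fn_one : (fn 1 : PsiDO d) = 1 := by
  ext i
  simp [coeff_fn, coeff_one, psiOne, Pi.single_apply]

/-- Multiplication operators, as a ring homomorphism. -/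
noncomputable def fnHom : A →+* PsiDO d where
  toFun := fn
  map_zero' := by ext i; simp [coeff_fn]
  map_one' := fn_one
  map_add' a b := by ext i; simp [coeff_fn, Pi.single_add]
  map_mul' a b := by
    ext i
    rw [fn_mul_coeff, coeff_fn, coeff_fn, Pi.single_apply, Pi.single_apply, mul_ite, mul_zero]

theorem del_one_mul_fn (a : A) : (del 1 * fn a : PsiDO d) = fn a * del 1 + fn (d a) := by
  ext i
  rw [del_one_mul_coeff, coeff_add, Pi.add_apply, fn_mul_coeff, coeff_fn, coeff_fn, coeff_del]
  by_cases h : i = 0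
  · subst h; simp
  · by_cases h1 : i = 1
    · subst h1; simp
    · have : i - 1 ≠ 0 := by omega
      simp [h, h1, this]

/-! ### The adjoint -/

/-- The formal adjoint. -/
noncomputable def adj : PsiDO d →+ PsiDO d where
  toFun P := mk (psiAdjoint d P.coeff) (P.exists_order.imp fun _ h => h.psiAdjoint d)
  map_zero' := by ext i; simp [psiAdjoint_apply]
  map_add' P Q := coeff_injective <| by
    obtain ⟨a, ha⟩ := P.exists_order
    obtain ⟨b, hb⟩ := Q.exists_order
    exact psiAdjoint_add d (ha.mono (le_max_left a b)) (hb.mono (le_max_right a b))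

theorem adj_mul (P Q : PsiDO d) : adj (P * Q) = adj Q * adj P := coeff_injective <| by
  obtain ⟨a, ha⟩ := P.exists_order
  obtain ⟨b, hb⟩ := Q.exists_order
  exact psiAdjoint_psiMul d ha hb

theorem adj_coeff_of_const {P : PsiDO d} (hP : ∀ i, d (P.coeff i) = 0) (n : ℤ) :
    (adj P).coeff n = (n.negOnePow : ℤ) • P.coeff n := psiAdjoint_apply_of_const d hP n

theorem adj_fn (a : A) : adj (fn a : PsiDO d) = fn a :=
  coeff_injective (psiAdjoint_single_zero d a)

theorem adj_one : adj (1 : PsiDO d) = 1 := by rw [← fn_one, adj_fn]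

theorem adj_del_one : adj (del 1 : PsiDO d) = -del 1 := by
  ext i
  rw [adj_coeff_of_const]
  · by_cases h : i = 1
    · subst h; simp [coeff_del]
    · simp [coeff_del, h]
  · intro i; rw [coeff_del, Pi.single_apply]; split_ifs <;> simp

/-! ### The differential operator part -/

/-- The differential operator part. -/
def nonneg (P : PsiDO d) : PsiDO d :=
  mk (psiNonneg P.coeff) (P.exists_order.imp fun b hb i hi => by simp [psiNonneg, hb i hi])

theorem coeff_nonneg (P : PsiDO d) : (nonneg P).coeff = psiNonneg P.coeff := rfl

theorem sub_nonneg_orderLE (P : PsiDO d) : (P - nonneg P).OrderLE (-1) := fun i hi => by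
  have : 0 ≤ i := by omega
  simp [coeff_nonneg, psiNonneg, this]

/-- A differential operator is a finite sum of the `a ∂ⁱ`. -/
theorem eq_sum_of_coeff_neg {P : PsiDO d} (hP : ∀ i < 0, P.coeff i = 0) :
    ∃ m : ℕ, P = ∑ i ∈ Finset.range m, fn (P.coeff i) * del 1 ^ i := by
  obtain ⟨b, hb⟩ := P.exists_order
  refine ⟨(b + 1).toNat, ?_⟩
  ext n
  rw [coeff_sum]
  simp only [del_one_pow, fn_mul_coeff, coeff_del]
  rcases lt_or_ge n 0 with hn | hn
  · rw [hP n hn, Finset.sum_eq_zero]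
    intro i _
    rw [Pi.single_eq_of_ne (by omega), mul_zero]
  · lift n to ℕ using hn
    by_cases hnb : n < (b + 1).toNat
    · rw [Finset.sum_eq_single_of_mem n (Finset.mem_range.2 hnb)]
      · simp
      · intro i _ hi
        rw [Pi.single_eq_of_ne (by exact_mod_cast hi.symm), mul_zero]
    · rw [hb n (by omega), Finset.sum_eq_zero]
      intro i hi
      rw [Finset.mem_range] at hi
      rw [Pi.single_eq_of_ne (by omega), mul_zero]

/-! ### Derivations commuting with `∂` -/

variable (δ : Derivation ℤ A A)

/-- A derivation of the coefficients, applied coefficientwise. -/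
noncomputable def deriv : PsiDO d →+ PsiDO d where
  toFun P := mk (fun i => δ (P.coeff i))
    (P.exists_order.imp fun _ h i hi => by simp only [h i hi, map_zero])
  map_zero' := by ext i; simp
  map_add' P Q := by ext i; simp

theorem coeff_deriv (P : PsiDO d) (i : ℤ) : (deriv δ P).coeff i = δ (P.coeff i) := rfl

theorem OrderLE.deriv {a : ℤ} {P : PsiDO d} (hP : P.OrderLE a) : (deriv δ P).OrderLE a :=
  fun i hi => by rw [coeff_deriv, hP i hi, map_zero]

theorem deriv_one : deriv δ (1 : PsiDO d) = 0 := by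
  ext i
  rw [coeff_deriv, coeff_one, psiOne]
  split_ifs <;> simp

theorem deriv_del (n : ℤ) : deriv δ (del n : PsiDO d) = 0 := by
  ext i
  rw [coeff_deriv, coeff_del, Pi.single_apply]
  split_ifs <;> simp

/-- Composition applies iterates of `d` to the coefficients of the right factor, so the product rule
for `δ` needs `δ` to commute with `d`. -/
theorem deriv_mul (h : ∀ a, δ (d a) = d (δ a)) (P Q : PsiDO d) :
    deriv δ (P * Q) = deriv δ P * Q + P * deriv δ Q := by
  have hk : ∀ (k : ℕ) a, δ (d.iter k a) = d.iter k (δ a) := by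
    intro k a
    induction k with
    | zero => simp only [d.iter_zero]
    | succ k ih => rw [d.iter_succ, d.iter_succ, h, ih]
  obtain ⟨a, ha⟩ := P.exists_order
  obtain ⟨b, hb⟩ := Q.exists_order
  ext n
  rw [coeff_deriv, coeff_add, Pi.add_apply, coeff_mul, coeff_mul, coeff_mul, psiMul_apply,
    psiMul_apply, psiMul_apply,
    ← finsum_add_distrib (psiMul_finite d (a := a) (OrderLE.deriv δ ha) hb n)
      (psiMul_finite d ha (b := b) (OrderLE.deriv δ hb) n)]
  refine ((δ : A →ₗ[ℤ] A).toAddMonoidHom.map_finsum (psiMul_finite d ha hb n)).trans ?_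
  refine finsum_congr fun p => ?_
  change δ _ = _
  rw [map_zsmul, δ.leibniz, hk, coeff_deriv, coeff_deriv, smul_eq_mul, smul_eq_mul, ← smul_add]
  congr 1
  ring

end PsiDO

/-! ### Sato theory: dressing operators, the Sato equation and the Lax equations. -/

namespace PsiDO

variable {A : Type*} [CommRing A] {d : Derivation ℤ A A}

/-! ### Operators determined by their differential operator part -/

section Tail

variable (c : ℕ → ℕ → A)

theorem pairing_finite (P : PsiDO d) (m : ℕ) :
    Function.HasFiniteSupport fun i : ℕ => P.coeff i * c i m := by
  obtain ⟨b, hb⟩ := P.exists_order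
  refine (Set.finite_Iio (b + 1).toNat).subset fun i hi => ?_
  have := hb.le_of_ne_zero (left_ne_zero_of_mul hi)
  rw [Set.mem_Iio]
  omega

/-- The deviation of the coefficient of `∂^{-m-1}` from the value `-∑ᵢ Pᵢ c i m` prescribed by the
differential operator part. -/
noncomputable def tailDefect (m : ℕ) : PsiDO d →+ A where
  toFun P := P.coeff (-(m + 1)) + ∑ᶠ i : ℕ, P.coeff i * c i m
  map_zero' := by simp
  map_add' P Q := by
    rw [show (fun i : ℕ => (P + Q).coeff i * c i m) =
      fun i : ℕ => P.coeff i * c i m + Q.coeff i * c i m from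
        funext fun i => by rw [coeff_add, Pi.add_apply, add_mul],
      finsum_add_distrib (pairing_finite c P m) (pairing_finite c Q m), coeff_add, Pi.add_apply]
    ring

theorem tailDefect_apply (m : ℕ) (P : PsiDO d) :
    tailDefect c m P = P.coeff (-(m + 1)) + ∑ᶠ i : ℕ, P.coeff i * c i m := rfl

theorem tailDefect_eq_sum (m : ℕ) (P : PsiDO d) (M : ℕ) (hM : ∀ i : ℕ, M ≤ i → P.coeff i = 0) :
    tailDefect c m P = P.coeff (-(m + 1)) + ∑ i ∈ Finset.range M, P.coeff i * c i m := by
  rw [tailDefect_apply, finsum_eq_sum_of_support_subset]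
  intro i hi
  rw [Finset.coe_range, Set.mem_Iio]
  by_contra h
  exact hi (by simp only [hM i (not_lt.1 h), zero_mul])

theorem exists_coeff_eq_zero (P : PsiDO d) : ∃ M : ℕ, ∀ i : ℕ, M ≤ i → P.coeff i = 0 := by
  obtain ⟨b, hb⟩ := P.exists_order
  exact ⟨(b + 1).toNat, fun i hi => hb i (by omega)⟩

theorem tailDefect_fn_mul (m : ℕ) (a : A) (P : PsiDO d) :
    tailDefect c m (fn a * P) = a * tailDefect c m P := by
  obtain ⟨M, hM⟩ := exists_coeff_eq_zero P
  rw [tailDefect_eq_sum c m P M hM, tailDefect_eq_sum c m _ M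
    (fun i hi => by rw [fn_mul_coeff, hM i hi, mul_zero]), mul_add, Finset.mul_sum]
  simp only [fn_mul_coeff, mul_assoc]

/-- Left multiplication by `∂` shifts `Pᵢ` to position `i + 1`, where `hc` rewrites `c (i + 1) m`.
Its quadratic term combines with `P_{-1} c 0 m`, the contribution of the residue that moves to
position `0`, into the last product. -/
theorem tailDefect_del_mul
    (hc : ∀ i m, c (i + 1) m = d (c i m) + c i (m + 1) + c i 0 * c 0 m) (m : ℕ) (P : PsiDO d) :
    tailDefect c m (del 1 * P) =
      d (tailDefect c m P) + tailDefect c (m + 1) P + tailDefect c 0 P * c 0 m := by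
  obtain ⟨M, hM⟩ := exists_coeff_eq_zero P
  have hM' : ∀ i : ℕ, M + 1 ≤ i → (del 1 * P).coeff i = 0 := fun i hi => by
    rw [del_one_mul_coeff, hM i (by omega), map_zero, zero_add]
    have := hM (i - 1) (by omega)
    rwa [Nat.cast_sub (by omega), Nat.cast_one] at this
  rw [tailDefect_eq_sum c m _ (M + 1) hM', tailDefect_eq_sum c m P M hM,
    tailDefect_eq_sum c (m + 1) P M hM, tailDefect_eq_sum c 0 P M hM]
  simp only [del_one_mul_coeff, add_mul, Finset.sum_add_distrib]
  rw [Finset.sum_range_succ, hM M le_rfl, Finset.sum_range_succ' _ M, map_add, map_sum]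
  simp only [Nat.cast_add, Nat.cast_one, add_sub_cancel_right, hc, d.leibniz, smul_eq_mul, mul_add,
    Finset.sum_add_distrib, Finset.sum_mul, Nat.cast_zero, zero_sub, map_zero, zero_mul, zero_add,
    add_zero, ← mul_assoc]
  rw [show -((m : ℤ) + 1) - 1 = -(m + 1 + 1) by ring, Finset.sum_congr rfl
    (fun i _ => mul_comm (c i m) (d (P.coeff i)))]
  ring

/-- The operators without defect form a left module over the differential operators: by the two
preceding product formulas they are stable under functions and under `∂`, which generate. -/
theorem tailDefect_mul_eq_zero
    (hc : ∀ i m, c (i + 1) m = d (c i m) + c i (m + 1) + c i 0 * c 0 m)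
    {B P : PsiDO d} (hB : ∀ i < 0, B.coeff i = 0) (hP : ∀ m, tailDefect c m P = 0) (m : ℕ) :
    tailDefect c m (B * P) = 0 := by
  have hpow : ∀ (k m : ℕ), tailDefect c m (del 1 ^ k * P) = 0 := by
    intro k
    induction k with
    | zero => simpa using hP
    | succ k ih =>
      intro m
      rw [pow_succ', mul_assoc, tailDefect_del_mul c hc, ih, ih, ih, map_zero, zero_mul, add_zero,
        add_zero]
  obtain ⟨M, hM⟩ := eq_sum_of_coeff_neg hB
  rw [hM, Finset.sum_mul, map_sum]
  refine Finset.sum_eq_zero fun i _ => ?_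
  rw [mul_assoc, tailDefect_fn_mul, hpow, mul_zero]

/-- Without defect the negative coefficients are determined by the nonnegative ones, which vanish
here. -/
theorem eq_zero_of_tailDefect {P : PsiDO d} (hP : ∀ m, tailDefect c m P = 0)
    (hneg : P.OrderLE (-1)) : P = 0 := by
  ext i
  rcases lt_or_ge (-1) i with hi | hi
  · exact hneg i hi
  · have := hP (-i - 1).toNat
    rw [tailDefect_eq_sum c _ P 0 (fun i _ => hneg i (by omega)), Finset.sum_range_zero, add_zero,
      show -((((-i - 1).toNat : ℕ) : ℤ) + 1) = i by omega] at this
    exact this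

end Tail

/-! ### Dressing -/

/-- The dressing operator `1 - ∑ₘ wₘ ∂^{-m-1}`. -/
def dressing (w : ℕ → A) : PsiDO d :=
  mk (fun i => if i = 0 then 1 else if i < 0 then -w (-i - 1).toNat else 0)
    ⟨0, fun _ hi => (if_neg hi.ne').trans (if_neg hi.not_gt)⟩

section Dressing

variable (w : ℕ → A)

theorem dressing_coeff_zero : (dressing w : PsiDO d).coeff 0 = 1 := rfl

theorem dressing_coeff_neg (m : ℕ) : (dressing w : PsiDO d).coeff (-(m + 1)) = -w m := by
  rw [dressing, coeff_mk, if_neg (by omega), if_pos (by omega)]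
  congr 2; omega

theorem dressing_coeff_pos {i : ℤ} (hi : 0 < i) : (dressing w : PsiDO d).coeff i = 0 := by
  rw [dressing, coeff_mk, if_neg hi.ne', if_neg (by omega)]

theorem one_sub_dressing_orderLE : (1 - dressing w : PsiDO d).OrderLE (-1) := fun i hi => by
  rcases (show 0 ≤ i by omega).eq_or_lt with rfl | h
  · simp [coeff_one, psiOne, dressing_coeff_zero]
  · simp [coeff_one, psiOne, dressing_coeff_pos w h, h.ne']

/-- The Sato equation: `W_t + W ∂ⁿ` is a left multiple of `W` by a differential operator. -/
theorem exists_sato (c : ℕ → ℕ → A) (δ : Derivation ℤ A A) (n : ℕ)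
    (hc : ∀ i m, c (i + 1) m = d (c i m) + c i (m + 1) + c i 0 * c 0 m)
    (hδ : ∀ m, c n m = δ (c 0 m) + c 0 (n + m) +
      ∑ i ∈ Finset.range n, c 0 (n - 1 - i) * c i m) :
    ∃ B : PsiDO d, (∀ i < 0, B.coeff i = 0) ∧
      deriv δ (dressing (c 0)) + dressing (c 0) * del n = B * dressing (c 0) := by
  set W : PsiDO d := dressing (c 0) with hWdef
  have hW : ∀ m, tailDefect c m W = 0 := fun m => by
    rw [tailDefect_eq_sum c m W 1 (fun i hi => dressing_coeff_pos _ (by omega)),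
      dressing_coeff_neg, Finset.sum_range_one, Nat.cast_zero, dressing_coeff_zero]
    ring
  set G : PsiDO d := deriv δ W + W * del n with hGdef
  have hGc : ∀ i, G.coeff i = δ (W.coeff i) + W.coeff (i - n) := fun i => by
    rw [hGdef, coeff_add, Pi.add_apply, coeff_deriv, mul_del_coeff]
  -- The nonnegative part of `G` is `∂ⁿ - ∑_{i < n} c 0 (n-1-i) ∂ⁱ` and its coefficient at `-m-1` is
  -- `-δ (c 0 m) - c 0 (n+m)`, so vanishing of the defect is exactly `hδ`.
  have hG : ∀ m, tailDefect c m G = 0 := fun m => by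
    have hnn : ∀ i : ℕ, δ (W.coeff i) = 0 := fun i => by
      rcases i.eq_zero_or_pos with rfl | h
      · rw [Nat.cast_zero, dressing_coeff_zero, δ.map_one_eq_zero]
      · rw [dressing_coeff_pos _ (by omega), map_zero]
    rw [tailDefect_eq_sum c m G (n + 1) fun i hi => by
      rw [hGc, hnn, dressing_coeff_pos _ (by omega), add_zero], Finset.sum_range_succ, hGc,
      dressing_coeff_neg, show -((m : ℤ) + 1) - n = -((n + m : ℕ) + 1) by push_cast; ring,
      dressing_coeff_neg, hGc, hnn, sub_self, dressing_coeff_zero, hδ m, Finset.sum_congr rfl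
      (g := fun i => -(c 0 (n - 1 - i) * c i m)) fun i hi => by
        rw [Finset.mem_range] at hi
        rw [hGc, hnn, show (i : ℤ) - n = -((n - 1 - i : ℕ) + 1) by omega, dressing_coeff_neg]
        ring, Finset.sum_neg_distrib, map_neg]
    ring
  obtain ⟨X, hXW, -, -⟩ := isUnit_of_order_sub_one (one_sub_dressing_orderLE (d := d) (c 0))
  have hB : ∀ i < 0, (nonneg (G * X)).coeff i = 0 := fun i hi => by
    rw [coeff_nonneg, psiNonneg, if_neg (by omega)]
  -- With `X = W⁻¹`, this choice of `B` leaves in `G - B W` only the negative part of `G W⁻¹` times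
  -- `W`, of order at most `-1`. The difference also has no defect, hence it is zero.
  refine ⟨nonneg (G * X), hB, ?_⟩
  rw [← sub_eq_zero]
  refine eq_zero_of_tailDefect c (fun m => ?_) ?_
  · rw [map_sub, hG, tailDefect_mul_eq_zero c hc hB hW, sub_zero]
  · have h1 : G - nonneg (G * X) * W = (G * X - nonneg (G * X)) * W := by
      rw [sub_mul, mul_assoc G, hXW, mul_one]
    rw [h1]
    have hW0 : W.OrderLE 0 := fun i hi => dressing_coeff_pos _ hi
    exact (((sub_nonneg_orderLE _).mul hW0).mono (by norm_num))

theorem deriv_self_eq (P : PsiDO d) : deriv d P = del 1 * P - P * del 1 := by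
  ext i
  rw [coeff_deriv, coeff_sub, Pi.sub_apply, del_one_mul_coeff, mul_del_coeff]
  ring

section Lax

variable {W X B : PsiDO d} (hW : (1 - W).OrderLE (-1)) (hXW : X * W = 1) (hWX : W * X = 1)
  (hX : (1 - X).OrderLE (-1))

-- Since `[∂, W]` is the coefficientwise derivative of `W`, the difference is `-W' W⁻¹`, and
-- differentiation kills the leading coefficient `1` of `W`.
include hW hWX hX in
theorem lax_sub_del_orderLE : (W * del 1 * X - del 1).OrderLE (-1) := by
  have h1 : W * del 1 * X - del 1 = deriv d (1 - W) * X := by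
    rw [map_sub, deriv_one, deriv_self_eq, zero_sub, neg_sub, sub_mul, mul_assoc (del 1), hWX,
      mul_one]
  have hX0 : X.OrderLE 0 := by
    rw [← sub_sub_cancel 1 X]
    exact orderLE_one.sub (hX.mono (by norm_num))
  rw [h1]
  exact ((hW.deriv d).mul hX0).mono (by norm_num)

include hXW in
theorem lax_pow (n : ℕ) (hWX : W * X = 1) : (W * del 1 * X) ^ n = W * del n * X := by
  induction n with
  | zero => simp [del_zero, hWX]
  | succ n ih =>
    rw [pow_succ, ih, show W * del n * X * (W * del 1 * X) = W * del n * (X * W) * del 1 * X by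
      simp only [mul_assoc], hXW, mul_one, mul_assoc W, del_mul_del]
    push_cast; rfl

variable (δ : Derivation ℤ A A) (n : ℕ) (hB : ∀ i < 0, B.coeff i = 0)
  (hS : deriv δ W + W * del n = B * W)

-- The Sato equation times `W⁻¹` splits the power of the Lax operator into `B` and a remainder of
-- order at most `-1`; its differential part and its residue can be read off.
include hXW hWX hS in
theorem lax_pow_eq : (W * del 1 * X) ^ n = B - deriv δ W * X := by
  rw [lax_pow hXW n hWX, eq_sub_of_add_eq' hS, sub_mul, mul_assoc B, hWX, mul_one]

include hW hX in
theorem deriv_mul_inv_orderLE : (deriv δ W * X).OrderLE (-1) ∧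
    (deriv δ W * X).coeff (-1) = δ (W.coeff (-1)) := by
  have hX0 : X.OrderLE 0 := by
    rw [← sub_sub_cancel 1 X]
    exact orderLE_one.sub (hX.mono (by norm_num))
  have hW1 : (deriv δ W).OrderLE (-1) := by
    have : deriv δ W = -deriv δ (1 - W) := by rw [map_sub, deriv_one, zero_sub, neg_neg]
    rw [this]
    exact (hW.deriv δ).neg
  refine ⟨(hW1.mul hX0).mono (by norm_num), ?_⟩
  have := coeff_mul_leading hW1 hX0
  have h0 : X.coeff 0 = 1 := by
    have := hX 0 (by norm_num)
    rw [coeff_sub, Pi.sub_apply, coeff_one, sub_eq_zero] at this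
    simpa [psiOne] using this.symm
  rwa [add_zero, h0, mul_one] at this

include hW hXW hWX hX hB hS in
theorem nonneg_lax_pow : nonneg ((W * del 1 * X) ^ n) = B := by
  ext i
  rw [lax_pow_eq hXW hWX δ n hS, coeff_nonneg, psiNonneg]
  split_ifs with hi
  · rw [coeff_sub, Pi.sub_apply, (deriv_mul_inv_orderLE hW hX δ).1 i (by omega), sub_zero]
  · rw [hB i (by omega)]

include hW hXW hWX hX hB hS in
theorem res_lax_pow : ((W * del 1 * X) ^ n).coeff (-1) = -δ (W.coeff (-1)) := by
  rw [lax_pow_eq hXW hWX δ n hS, coeff_sub, Pi.sub_apply, hB _ (by norm_num),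
    (deriv_mul_inv_orderLE hW hX δ).2, zero_sub]

-- By the splitting, `B` is the `n`-th power of the Lax operator plus `W_t W⁻¹`. The power commutes
-- with the Lax operator, and the commutator with `W_t W⁻¹` is what differentiating `W ∂ W⁻¹`
-- produces.
include hW hXW hWX hX hB hS in
theorem deriv_lax (hδ : ∀ a, δ (d a) = d (δ a)) :
    deriv δ (W * del 1 * X) =
      nonneg ((W * del 1 * X) ^ n) * (W * del 1 * X) -
        (W * del 1 * X) * nonneg ((W * del 1 * X) ^ n) := by
  have hXd : deriv δ X = -(X * deriv δ W * X) := by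
    have h := deriv_mul δ hδ X W
    rw [hXW, deriv_one] at h
    have h2 : deriv δ X * W * X = -(X * deriv δ W) * X := by
      rw [eq_neg_of_add_eq_zero_left h.symm]
    rwa [mul_assoc, hWX, mul_one, neg_mul] at h2
  have hB' : B = (W * del 1 * X) ^ n + deriv δ W * X := by
    rw [lax_pow_eq hXW hWX δ n hS, sub_add_cancel]
  rw [nonneg_lax_pow hW hXW hWX hX δ n hB hS, hB', add_mul, mul_add, ← pow_succ, ← pow_succ',
    deriv_mul δ hδ, deriv_mul δ hδ, deriv_del, hXd, mul_zero, add_zero,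
    show deriv δ W * X * (W * del 1 * X) = deriv δ W * (X * W) * del 1 * X by
      simp only [mul_assoc], hXW, mul_one]
  simp only [mul_assoc, mul_neg]
  abel

-- From `L W = W ∂` and its adjoint `W* L* = -∂ W*` one gets `W*(L + L*)W = [W*W, ∂]`, which
-- vanishes for constant coefficients; then `W` and `W*` are cancelled.
include hXW hWX in
theorem lax_add_adj_eq_zero (hC : ∀ i, d ((adj W * W).coeff i) = 0) :
    W * del 1 * X + adj (W * del 1 * X) = 0 := by
  set L := W * del 1 * X with hL
  have hLW : L * W = W * del 1 := by rw [hL, mul_assoc, hXW, mul_one]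
  have hWL : adj W * adj L = -(del 1 * adj W) := by
    rw [← adj_mul, hLW, adj_mul, adj_del_one, neg_mul]
  have hcomm : del 1 * (adj W * W) = adj W * W * del 1 := by
    have : deriv d (adj W * W) = 0 := by
      ext i
      rw [coeff_deriv, hC]; rfl
    rw [deriv_self_eq, sub_eq_zero] at this
    exact this
  have hadj : adj X * adj W = 1 := by rw [← adj_mul, hWX, adj_one]
  have key : adj W * (L + adj L) * W = 0 := by
    rw [mul_add, add_mul, mul_assoc, hLW, hWL, neg_mul, ← mul_assoc, mul_assoc (del 1), hcomm,
      add_neg_cancel]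
  calc L + adj L = adj X * adj W * (L + adj L) * (W * X) := by
        rw [hadj, hWX, one_mul, mul_one]
    _ = adj X * (adj W * (L + adj L) * W) * X := by simp only [mul_assoc]
    _ = 0 := by rw [key, mul_zero, zero_mul]

end Lax

end Dressing

end PsiDO

open Matrix

/-! ### Matrix Riccati flows and their scalar moments. -/

section MatrixDerivation

variable {A : Type*} [CommRing A] {l m n : Type*} [Fintype m]

theorem Matrix.map_derivation_mul (δ : Derivation ℤ A A) (M : Matrix l m A) (N : Matrix m n A) :
    (M * N).map δ = M.map δ * N + M * N.map δ := by
  ext i j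
  simp only [map_apply, mul_apply, add_apply, map_sum, δ.leibniz, smul_eq_mul,
    ← Finset.sum_add_distrib]
  exact Finset.sum_congr rfl fun k _ => by ring

theorem Matrix.map_derivation_pow [DecidableEq m] (δ : Derivation ℤ A A) {M : Matrix m m A}
    (hM : M.map δ = 0) (k : ℕ) : (M ^ k).map δ = 0 := by
  induction k with
  | zero => ext i j; by_cases h : i = j <;> simp [h]
  | succ k ih => rw [pow_succ, Matrix.map_derivation_mul, ih, hM, zero_mul, mul_zero, add_zero]

end MatrixDerivation

section Sandwich

variable {A : Type*} [CommRing A] {n : Type*} [Fintype n]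

/-- The scalar `vᵀ M v`. -/
def sandwich (v : n → A) : Matrix n n A →+ A where
  toFun M := v ⬝ᵥ (M *ᵥ v)
  map_zero' := by simp
  map_add' M N := by rw [add_mulVec, dotProduct_add]

theorem sandwich_apply (v : n → A) (M : Matrix n n A) : sandwich v M = v ⬝ᵥ (M *ᵥ v) := rfl

/-- The only use of rank one: it turns the quadratic matrix term of the Riccati equation into a
product of scalars. -/
theorem sandwich_mul_vecMulVec_mul (v : n → A) (M N : Matrix n n A) :
    sandwich v (M * vecMulVec v v * N) = sandwich v M * sandwich v N := by
  simp only [sandwich_apply, ← mulVec_mulVec]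
  rw [vecMulVec_mulVec, op_smul_eq_smul, mulVec_smul, dotProduct_smul, smul_eq_mul, mul_comm]

theorem derivation_sandwich (δ : Derivation ℤ A A) {v : n → A} (hv : ∀ i, δ (v i) = 0)
    (M : Matrix n n A) : δ (sandwich v M) = sandwich v (M.map δ) := by
  simp only [sandwich_apply, dotProduct, mulVec, map_sum, δ.leibniz, hv, smul_eq_mul, mul_zero,
    add_zero, zero_add, map_apply]
  refine Finset.sum_congr rfl fun i _ => ?_
  congr 1
  exact Finset.sum_congr rfl fun j _ => mul_comm _ _

end Sandwich

section BlockPowers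

variable {A : Type*} [CommRing A] {n : Type*} [Fintype n] [DecidableEq n]
  (R Q S L Φ : Matrix n n A)

/-- The upper block of `(R Q; S L)ⁱ (1; Φ)`. -/
def upperFlow (i : ℕ) : Matrix n n A :=
  (fromBlocks R Q S L ^ i).toBlocks₁₁ + (fromBlocks R Q S L ^ i).toBlocks₁₂ * Φ

/-- The lower block of `(R Q; S L)ⁱ (1; Φ)`. -/
def lowerFlow (i : ℕ) : Matrix n n A :=
  (fromBlocks R Q S L ^ i).toBlocks₂₁ + (fromBlocks R Q S L ^ i).toBlocks₂₂ * Φ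

theorem upperFlow_zero : upperFlow R Q S L Φ 0 = 1 := by
  rw [upperFlow, pow_zero, ← fromBlocks_one, toBlocks_fromBlocks₁₁, toBlocks_fromBlocks₁₂,
    zero_mul, add_zero]

theorem lowerFlow_zero : lowerFlow R Q S L Φ 0 = Φ := by
  rw [lowerFlow, pow_zero, ← fromBlocks_one, toBlocks_fromBlocks₂₁, toBlocks_fromBlocks₂₂,
    one_mul, zero_add]

theorem upperFlow_succ (i : ℕ) : upperFlow R Q S L Φ (i + 1) =
    R * upperFlow R Q S L Φ i + Q * lowerFlow R Q S L Φ i := by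
  simp only [upperFlow, lowerFlow]
  rw [pow_succ']
  conv_lhs => rw [← fromBlocks_toBlocks (fromBlocks R Q S L ^ i), fromBlocks_multiply,
    toBlocks_fromBlocks₁₁, toBlocks_fromBlocks₁₂]
  noncomm_ring

theorem lowerFlow_succ (i : ℕ) : lowerFlow R Q S L Φ (i + 1) =
    (fromBlocks R Q S L ^ i).toBlocks₂₁ * (R + Q * Φ) +
      (fromBlocks R Q S L ^ i).toBlocks₂₂ * (S + L * Φ) := by
  rw [lowerFlow, pow_succ]
  conv_lhs => rw [← fromBlocks_toBlocks (fromBlocks R Q S L ^ i), fromBlocks_multiply,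
    toBlocks_fromBlocks₂₁, toBlocks_fromBlocks₂₂]
  noncomm_ring

/-- A discrete Duhamel formula: the upper row of the recursion is solved with the lower block as
source. It supplies the finite sum in the flow of the moments. -/
theorem upperFlow_eq_sum (k : ℕ) : upperFlow R Q S L Φ k =
    R ^ k + ∑ i ∈ Finset.range k, R ^ (k - 1 - i) * Q * lowerFlow R Q S L Φ i := by
  induction k with
  | zero => rw [upperFlow_zero, pow_zero, Finset.sum_range_zero, add_zero]
  | succ k ih =>
    rw [upperFlow_succ, ih, Finset.sum_range_succ, mul_add, ← pow_succ', Finset.mul_sum, add_assoc,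
      Nat.add_sub_cancel, Nat.sub_self, pow_zero, one_mul]
    congr 2
    refine Finset.sum_congr rfl fun i hi => ?_
    rw [Finset.mem_range] at hi
    rw [← mul_assoc, ← mul_assoc, ← pow_succ']
    congr 3
    omega

variable {R Q S L Φ}

/-- The blocks of the powers of a matrix of constants are constants. -/
theorem fromBlocks_pow_map_derivation (δ : Derivation ℤ A A) (hR : R.map δ = 0) (hQ : Q.map δ = 0)
    (hS : S.map δ = 0) (hL : L.map δ = 0) (i : ℕ) : (fromBlocks R Q S L ^ i).map δ = 0 :=
  Matrix.map_derivation_pow δ (by rw [fromBlocks_map, hR, hQ, hS, hL, fromBlocks_zero]) i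

/-- The Riccati equation is equivalent to `H (1; Φ) = (1; Φ)(R + QΦ) + (0; Φ')`. Applying `Hⁱ` from
the left and taking the lower block gives the formula, since `Hⁱ` is constant. -/
theorem lowerFlow_succ_eq (d : Derivation ℤ A A) (hR : R.map d = 0) (hQ : Q.map d = 0)
    (hS : S.map d = 0) (hL : L.map d = 0)
    (hΦ : Φ.map d = S + L * Φ - Φ * R - Φ * Q * Φ) (i : ℕ) :
    lowerFlow R Q S L Φ (i + 1) = (lowerFlow R Q S L Φ i).map d + lowerFlow R Q S L Φ i * R +
      lowerFlow R Q S L Φ i * Q * Φ := by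
  have h := fromBlocks_pow_map_derivation d hR hQ hS hL i
  have h1 : (fromBlocks R Q S L ^ i).toBlocks₂₁.map d = 0 := by
    ext a b; exact congrFun (congrFun h (Sum.inr a)) (Sum.inl b)
  have h2 : (fromBlocks R Q S L ^ i).toBlocks₂₂.map d = 0 := by
    ext a b; exact congrFun (congrFun h (Sum.inr a)) (Sum.inr b)
  have h3 : (lowerFlow R Q S L Φ i).map d =
      (fromBlocks R Q S L ^ i).toBlocks₂₂ * (S + L * Φ - Φ * R - Φ * Q * Φ) := by
    rw [lowerFlow, Matrix.map_add _ (map_add d), h1, Matrix.map_derivation_mul, h2, hΦ, zero_mul,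
      zero_add, zero_add]
  rw [lowerFlow_succ, h3, lowerFlow]
  noncomm_ring

variable {v : n → A}

/-- The scalars `vᵀ gᵢ Rᵐ v`, where `gᵢ` is the lower block of `(R Q; S L)ⁱ (1; Φ)`. -/
def flowMoment (R Q S L Φ : Matrix n n A) (v : n → A) (i m : ℕ) : A :=
  sandwich v (lowerFlow R Q S L Φ i * R ^ m)

theorem flowMoment_succ (d : Derivation ℤ A A) (hR : R.map d = 0)
    (hQ : Q = vecMulVec v v) (hS : S.map d = 0) (hL : L.map d = 0) (hv : ∀ i, d (v i) = 0)
    (hΦ : Φ.map d = S + L * Φ - Φ * R - Φ * Q * Φ) (i m : ℕ) :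
    flowMoment R Q S L Φ v (i + 1) m = d (flowMoment R Q S L Φ v i m) +
      flowMoment R Q S L Φ v i (m + 1) +
        flowMoment R Q S L Φ v i 0 * flowMoment R Q S L Φ v 0 m := by
  have hQ' : Q.map d = 0 := by
    rw [hQ]; ext i j; simp [vecMulVec_apply, hv]
  simp only [flowMoment]
  rw [lowerFlow_succ_eq d hR hQ' hS hL hΦ, lowerFlow_zero, derivation_sandwich d hv,
    Matrix.map_derivation_mul, Matrix.map_derivation_pow d hR, mul_zero, add_zero, pow_zero,
    mul_one, ← sandwich_mul_vecMulVec_mul, ← hQ, pow_succ', add_mul, add_mul, map_add, map_add]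
  simp only [mul_assoc]

/-- The Riccati equation reads `g_k = δΦ + Φ u_k`; the Duhamel formula expands `u_k`, and each
factor `Q = v vᵀ` splits a moment in two. -/
theorem flowMoment_eq (δ : Derivation ℤ A A) (hR : R.map δ = 0)
    (hQ : Q = vecMulVec v v) (hv : ∀ i, δ (v i) = 0) (k : ℕ)
    (hΦ : Φ.map δ = lowerFlow R Q S L Φ k - Φ * upperFlow R Q S L Φ k) (m : ℕ) :
    flowMoment R Q S L Φ v k m = δ (flowMoment R Q S L Φ v 0 m) +
      flowMoment R Q S L Φ v 0 (k + m) +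
        ∑ i ∈ Finset.range k, flowMoment R Q S L Φ v 0 (k - 1 - i) *
          flowMoment R Q S L Φ v i m := by
  simp only [flowMoment, lowerFlow_zero]
  rw [derivation_sandwich δ hv, Matrix.map_derivation_mul, Matrix.map_derivation_pow δ hR, mul_zero,
    add_zero]
  simp only [← sandwich_mul_vecMulVec_mul, ← hQ]
  rw [← map_sum, ← map_add, ← map_add]
  congr 1
  rw [hΦ, upperFlow_eq_sum, pow_add, sub_mul]
  simp only [mul_add, add_mul, Finset.mul_sum, Finset.sum_mul, mul_assoc]
  abel

end BlockPowers

/-! ### Matrix operators, resolvents and the constancy of `W* W`. -/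

namespace PsiDO

variable {A : Type*} [CommRing A] {d : Derivation ℤ A A}

theorem mul_fn_coeff_of_const {a : A} (ha : d a = 0) (P : PsiDO d) (n : ℤ) :
    (P * fn a).coeff n = P.coeff n * a := by
  rw [coeff_mul, psiMul_apply, finsum_eq_single _ ((n, 0) : ℤ × ℕ)]
  · simp [coeff_fn, d.iter_zero]
  · rintro ⟨i, k⟩ hne
    rcases k with _ | k
    · have : n - i ≠ 0 := fun h => hne (Prod.ext (by simp only; omega) rfl)
      simp [coeff_fn, d.iter_zero, this]
    · have h1 : d ((Pi.single 0 a : ℤ → A) (n - i + ((k + 1 : ℕ) : ℤ))) = 0 := by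
        rw [Pi.single_apply]; split_ifs
        · exact ha
        · exact map_zero d
      have h2 : d.iter (k + 1) ((Pi.single 0 a : ℤ → A) (n - i + ((k + 1 : ℕ) : ℤ))) = 0 := by
        rw [← d.iter_iter k 1, show d.iter 1 _ = 0 from by simpa [d.iter_apply] using h1,
          map_zero]
      simp only at *
      rw [coeff_fn, h2, mul_zero, smul_zero]

theorem deriv_fn (δ : Derivation ℤ A A) (a : A) : deriv δ (fn a : PsiDO d) = fn (δ a) := by
  ext i
  rw [coeff_deriv, coeff_fn, coeff_fn, Pi.single_apply, Pi.single_apply, apply_ite δ, map_zero]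

section MatrixOperators

variable {l m n : Type*} [Fintype m]

/-- Matrices of functions as matrices of operators. -/
noncomputable def fnMatrix (M : Matrix l n A) : Matrix l n (PsiDO d) :=
  M.map (fnHom : A →+* PsiDO d)

theorem fnMatrix_apply (M : Matrix l n A) (i : l) (j : n) :
    (fnMatrix M : Matrix l n (PsiDO d)) i j = fn (M i j) := rfl

theorem fnMatrix_mul (M : Matrix l m A) (N : Matrix m n A) :
    (fnMatrix (M * N) : Matrix l n (PsiDO d)) = fnMatrix M * fnMatrix N := Matrix.map_mul

theorem fnMatrix_add (M N : Matrix l n A) :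
    (fnMatrix (M + N) : Matrix l n (PsiDO d)) = fnMatrix M + fnMatrix N :=
  Matrix.map_add _ (map_add fnHom) M N

theorem fnMatrix_sub (M N : Matrix l n A) :
    (fnMatrix (M - N) : Matrix l n (PsiDO d)) = fnMatrix M - fnMatrix N :=
  Matrix.map_sub _ (map_sub fnHom) M N

/-- The adjoint of a matrix of operators. -/
noncomputable def adjMatrix (M : Matrix l n (PsiDO d)) : Matrix n l (PsiDO d) := Mᵀ.map adj

theorem adjMatrix_mul (M : Matrix l m (PsiDO d)) (N : Matrix m n (PsiDO d)) :
    adjMatrix (M * N) = adjMatrix N * adjMatrix M := by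
  ext1 i j
  simp only [adjMatrix, map_apply, transpose_apply, mul_apply, map_sum, adj_mul]

theorem adjMatrix_fnMatrix (M : Matrix l n A) :
    adjMatrix (fnMatrix M : Matrix l n (PsiDO d)) = fnMatrix Mᵀ := by
  ext1 i j
  exact adj_fn _

theorem map_deriv_mul (M : Matrix l m (PsiDO d)) (N : Matrix m n (PsiDO d)) :
    (M * N).map (deriv d) = M.map (deriv d) * N + M * N.map (deriv d) := by
  ext1 i j
  simp only [map_apply, mul_apply, map_sum, deriv_mul d (fun _ => rfl), Matrix.add_apply,
    Finset.sum_add_distrib]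

theorem map_deriv_fnMatrix {M : Matrix l n A} (hM : M.map d = 0) :
    (fnMatrix M : Matrix l n (PsiDO d)).map (deriv d) = 0 := by
  ext1 i j
  have h : d (M i j) = 0 := congrFun (congrFun hM i) j
  rw [map_apply, fnMatrix_apply, deriv_fn, h]
  exact map_zero fnHom

end MatrixOperators

theorem one_apply_coeff {n : Type*} [DecidableEq n] (i j : n) (k : ℤ) :
    ((1 : Matrix n n (PsiDO d)) i j).coeff k = if k = 0 then (1 : Matrix n n A) i j else 0 := by
  rw [one_apply, one_apply]
  split_ifs with h1 h2 h2 <;> simp [coeff_one, psiOne, h2]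

section Resolvent

variable {n : Type*} [Fintype n] [DecidableEq n]

/-- The resolvent `(∂ - M)⁻¹ = ∑ₘ Mᵐ ∂^{-m-1}` of a constant matrix `M`. -/
def resolvent (M : Matrix n n A) : Matrix n n (PsiDO d) := Matrix.of fun i j =>
  mk (fun k => if k < 0 then (M ^ (-k - 1).toNat) i j else 0)
    ⟨-1, fun _ hk => if_neg (by omega)⟩

theorem resolvent_coeff (M : Matrix n n A) (i j : n) (k : ℤ) :
    (resolvent M i j : PsiDO d).coeff k = if k < 0 then (M ^ (-k - 1).toNat) i j else 0 := rfl

/-- The scalar matrix `∂`. -/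
noncomputable def delMatrix : Matrix n n (PsiDO d) := diagonal fun _ => del 1

theorem delMatrix_mul_fnMatrix (M : Matrix n n A) :
    (delMatrix * fnMatrix M : Matrix n n (PsiDO d)) =
      fnMatrix M * delMatrix + fnMatrix (M.map d) := by
  ext1 i j
  rw [delMatrix, diagonal_mul, Matrix.add_apply, mul_diagonal, fnMatrix_apply, fnMatrix_apply,
    del_one_mul_fn]
  rfl

variable {M : Matrix n n A} (hM : M.map d = 0)

include hM

theorem resolvent_coeff_const (i j : n) (k : ℤ) :
    d ((resolvent M i j : PsiDO d).coeff k) = 0 := by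
  rw [resolvent_coeff]
  split_ifs
  · exact congrFun (congrFun (Matrix.map_derivation_pow d hM _) i) j
  · exact map_zero d

theorem map_deriv_resolvent : (resolvent M : Matrix n n (PsiDO d)).map (deriv d) = 0 := by
  ext i j k
  rw [map_apply, coeff_deriv, resolvent_coeff_const hM]; rfl

theorem delMatrix_sub_mul_resolvent :
    (delMatrix - fnMatrix M) * (resolvent M : Matrix n n (PsiDO d)) = 1 := by
  ext i j k
  rw [sub_mul, Matrix.sub_apply, coeff_sub, Pi.sub_apply, delMatrix, diagonal_mul,
    coeff_del_mul_of_const (resolvent_coeff_const hM i j), mul_apply, coeff_sum,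
    one_apply_coeff]
  simp only [fnMatrix_apply, fn_mul_coeff, resolvent_coeff]
  rcases lt_trichotomy k 0 with hk | rfl | hk
  · rw [if_pos (by omega), if_neg hk.ne]
    simp only [if_pos hk]
    rw [← mul_apply, ← pow_succ', show (-(k - 1) - 1).toNat = (-k - 1).toNat + 1 by omega, sub_self]
  · simp
  · rw [if_neg (by omega), if_neg hk.ne']
    simp [hk.not_gt]

theorem resolvent_mul_delMatrix_sub :
    (resolvent M : Matrix n n (PsiDO d)) * (delMatrix - fnMatrix M) = 1 := by
  ext i j k
  rw [mul_sub, Matrix.sub_apply, coeff_sub, Pi.sub_apply, delMatrix, mul_diagonal,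
    mul_del_coeff, mul_apply, coeff_sum, one_apply_coeff]
  have hc : ∀ a b, d (M a b) = 0 := fun a b => congrFun (congrFun hM a) b
  simp only [fnMatrix_apply, mul_fn_coeff_of_const (hc _ _), resolvent_coeff]
  rcases lt_trichotomy k 0 with hk | rfl | hk
  · rw [if_pos (by omega), if_neg hk.ne]
    simp only [if_pos hk]
    rw [← mul_apply, ← pow_succ, show (-(k - 1) - 1).toNat = (-k - 1).toNat + 1 by omega, sub_self]
  · simp
  · rw [if_neg (by omega), if_neg hk.ne']
    simp [hk.not_gt]

/-- Formally `((∂ - M)⁻¹)* = (-∂ - Mᵀ)⁻¹`. Constancy of `M` reduces this to comparing the signs of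
the coefficients. -/
theorem adjMatrix_resolvent :
    adjMatrix (resolvent M : Matrix n n (PsiDO d)) = -resolvent (-Mᵀ) := by
  ext i j k
  rw [adjMatrix, map_apply, transpose_apply, adj_coeff_of_const (resolvent_coeff_const hM j i),
    Matrix.neg_apply, coeff_neg, Pi.neg_apply, resolvent_coeff, resolvent_coeff]
  split_ifs with hk
  · obtain ⟨m, rfl⟩ : ∃ m : ℕ, k = -(m + 1) := ⟨(-k - 1).toNat, by omega⟩
    rw [show (-(-((m : ℤ) + 1)) - 1).toNat = m by omega, Int.negOnePow_neg, Int.negOnePow_succ]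
    rcases Nat.even_or_odd m with hm | hm
    · rw [hm.neg_pow, ← transpose_pow, transpose_apply,
        Int.negOnePow_even _ ((Int.even_coe_nat m).2 hm)]
      simp
    · rw [hm.neg_pow, ← transpose_pow, Matrix.neg_apply, transpose_apply,
        Int.negOnePow_odd _ (by exact_mod_cast hm)]
      simp
  · simp

end Resolvent

section AdjointDressing

variable {n : Type*} [Fintype n] [DecidableEq n] {R Q S L Φ : Matrix n n A} {v : n → A}

/-- For symmetric `Φ` the dressing operator is orthogonal up to constant coefficients. -/
theorem adj_dressing_mul_dressing_const (hR : R.map d = 0) (hS : S.map d = 0) (hL : L.map d = 0)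
    (hv : ∀ i, d (v i) = 0) (hRL : R = -Lᵀ) (hQ : Q = vecMulVec v v)
    (hΦ : Φ.map d = S + L * Φ - Φ * R - Φ * Q * Φ) (hsymm : Φᵀ = Φ) (k : ℤ) :
    d ((adj (dressing fun m => sandwich v (Φ * R ^ m)) *
      (dressing fun m => sandwich v (Φ * R ^ m)) : PsiDO d).coeff k) = 0 := by
  set W : PsiDO d := dressing fun m => sandwich v (Φ * R ^ m) with hW
  set r : Matrix Unit n (PsiDO d) := fnMatrix (replicateRow Unit v) with hr
  set s : Matrix n Unit (PsiDO d) := fnMatrix (replicateCol Unit v) with hs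
  set Gr : Matrix n n (PsiDO d) := resolvent R with hGr
  set Gl : Matrix n n (PsiDO d) := resolvent L with hGl
  set F : Matrix n n (PsiDO d) := fnMatrix Φ with hF
  set WM : Matrix Unit Unit (PsiDO d) := Matrix.of fun _ _ => W with hWM
  -- This is `W = 1 - vᵀΦ(∂ - R)⁻¹v`, as a `1 × 1` matrix so that it factors through rectangular
  -- matrices of operators.
  have hWM' : WM = 1 - r * (F * Gr) * s := by
    ext i j k
    have h1 : ((r * (F * Gr) * s) i j).coeff k =
        if k < 0 then sandwich v (Φ * R ^ (-k - 1).toNat) else 0 := by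
      simp only [hr, hs, hF, hGr, mul_apply, fnMatrix_apply, Finset.sum_mul, coeff_sum,
        mul_fn_coeff_of_const (hv _), fn_mul_coeff, replicateRow_apply, replicateCol_apply,
        resolvent_coeff, Finset.mul_sum]
      split_ifs
      · simp only [sandwich_apply, dotProduct, mulVec, mul_apply, Finset.mul_sum, Finset.sum_mul]
        rw [Finset.sum_comm]
        simp only [mul_assoc]
      · simp
    rw [Matrix.sub_apply, coeff_sub, Pi.sub_apply, one_apply_coeff, h1]
    change W.coeff k = _
    rw [hW, dressing, coeff_mk, Subsingleton.elim i j, one_apply_eq]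
    rcases lt_trichotomy k 0 with hk | rfl | hk
    · simp [hk, hk.ne]
    · simp
    · simp [hk.ne', hk.not_gt]
  have hLR : -Rᵀ = L := by rw [hRL, transpose_neg, transpose_transpose, neg_neg]
  have hadj : adjMatrix WM = 1 + r * (Gl * F) * s := by
    have h1 : adjMatrix (1 : Matrix Unit Unit (PsiDO d)) = 1 := by
      ext1 i j; simp [adjMatrix, adj_one]
    have hsub : ∀ M N : Matrix Unit Unit (PsiDO d), adjMatrix (M - N) = adjMatrix M - adjMatrix N :=
      fun M N => by ext1 i j; exact map_sub adj _ _
    rw [hWM', hsub, h1, adjMatrix_mul, adjMatrix_mul, adjMatrix_mul, hGr, adjMatrix_resolvent hR,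
      hLR, hF, adjMatrix_fnMatrix Φ, hsymm, hr, adjMatrix_fnMatrix, hs, adjMatrix_fnMatrix,
      transpose_replicateCol, transpose_replicateRow, ← hGl, neg_mul, Matrix.neg_mul,
      Matrix.mul_neg, sub_neg_eq_add, ← Matrix.mul_assoc]
  have hsr : s * r = fnMatrix Q := by
    rw [hQ, vecMulVec_eq Unit]
    exact (fnMatrix_mul _ _).symm
  -- As operators, `(∂ - L)Φ - Φ(∂ - R) = S - ΦQΦ` by the Riccati equation; it is multiplied by the
  -- resolvents on both sides.
  have hkey : F * Gr - Gl * F = Gl * (fnMatrix S - F * fnMatrix Q * F) * Gr := by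
    have h1 : (delMatrix - fnMatrix L) * F - F * (delMatrix - fnMatrix R) =
        fnMatrix S - F * fnMatrix Q * F := by
      have h2 : delMatrix * F = F * delMatrix +
          (fnMatrix S + fnMatrix L * F - F * fnMatrix R - F * fnMatrix Q * F) := by
        rw [hF, delMatrix_mul_fnMatrix, hΦ]
        simp only [fnMatrix_add, fnMatrix_sub, fnMatrix_mul]
        rfl
      rw [sub_mul, h2, mul_sub]
      abel
    rw [← h1, mul_sub, ← mul_assoc, resolvent_mul_delMatrix_sub hL, one_mul, sub_mul, ← mul_assoc,
      mul_assoc _ _ Gr, delMatrix_sub_mul_resolvent hR, mul_one]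
  -- The cross term of the product is `Gl Φ Q Φ Gr`, which cancels the quadratic term of `hkey`; no
  -- `Φ` survives.
  have hprod : adjMatrix WM * WM = 1 - r * (Gl * fnMatrix S * Gr) * s := by
    have h2 : Gl * fnMatrix S * Gr = F * Gr - Gl * F + Gl * F * (s * r) * (F * Gr) := by
      rw [hkey, hsr]; noncomm_ring
    rw [h2, hadj, hWM']
    simp only [Matrix.mul_add, Matrix.add_mul, Matrix.mul_sub, Matrix.sub_mul, Matrix.mul_assoc,
      Matrix.one_mul, Matrix.mul_one]
    abel
  have hconst : (adjMatrix WM * WM).map (deriv d) = 0 := by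
    have hrd : r.map (deriv d) = 0 := map_deriv_fnMatrix (by ext i j; exact hv j)
    have hsd : s.map (deriv d) = 0 := map_deriv_fnMatrix (by ext i j; exact hv i)
    have h1 : (1 : Matrix Unit Unit (PsiDO d)).map (deriv d) = 0 := by
      ext1 i j; simp [deriv_one]
    rw [hprod, Matrix.map_sub _ (map_sub (deriv d)), h1]
    simp only [map_deriv_mul, hrd, hsd, hGl, hGr, map_deriv_resolvent hL, map_deriv_resolvent hR,
      map_deriv_fnMatrix hS, Matrix.zero_mul, Matrix.mul_zero, add_zero, sub_zero]
  have h := congrFun (congrFun hconst ()) ()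
  have h' : deriv d (adj W * W) = 0 := by
    rw [map_apply, mul_apply, Fintype.sum_unique] at h
    exact h
  rw [← coeff_deriv, h']; rfl

end AdjointDressing

end PsiDO

/-! ### The Lax operator over an abstract differential ring. -/

section CKPLax

variable {A : Type*} [CommRing A] {n : Type*} [Fintype n] [DecidableEq n]
  {R Q S L Φ : Matrix n n A} {v : n → A}

/-- The Lax operator of a symmetric solution of the odd Riccati hierarchy in a differential ring. -/
theorem exists_ckp_laxOperator (δ : ℕ → Derivation ℤ A A)
    (hcomm : ∀ k a, δ k (δ 0 a) = δ 0 (δ k a))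
    (hR : ∀ k, R.map (δ k) = 0) (hS : ∀ k, S.map (δ k) = 0) (hL : ∀ k, L.map (δ k) = 0)
    (hv : ∀ k i, δ k (v i) = 0) (hRL : R = -Lᵀ) (hQ : Q = vecMulVec v v)
    (hΦ : ∀ k, Φ.map (δ k) =
      lowerFlow R Q S L Φ (2 * k + 1) - Φ * upperFlow R Q S L Φ (2 * k + 1))
    (hsymm : Φᵀ = Φ) :
    ∃ p : ℤ → A, p 1 = 1 ∧ p 0 = 0 ∧ PsiOrderLE 1 p ∧ (∀ i, p i + psiAdjoint (δ 0) p i = 0) ∧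
      (∀ k i, δ k (p i) = psiMul (δ 0) (psiNonneg (psiPow (δ 0) p (2 * k + 1))) p i -
        psiMul (δ 0) p (psiNonneg (psiPow (δ 0) p (2 * k + 1))) i) ∧
      ∀ k, psiRes (psiPow (δ 0) p (2 * k + 1)) = δ k (sandwich v Φ) := by
  have hΦ0 : Φ.map (δ 0) = S + L * Φ - Φ * R - Φ * Q * Φ := by
    rw [hΦ 0, mul_zero, zero_add, show 1 = 0 + 1 from rfl, lowerFlow_succ, upperFlow_succ,
      upperFlow_zero, lowerFlow_zero, pow_zero, ← fromBlocks_one, toBlocks_fromBlocks₂₁,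
      toBlocks_fromBlocks₂₂]
    noncomm_ring
  set c : ℕ → ℕ → A := flowMoment R Q S L Φ v with hc
  have hc0 : c 0 = fun m => sandwich v (Φ * R ^ m) := by
    funext m; rw [hc, flowMoment, lowerFlow_zero]
  have hrec := flowMoment_succ (δ 0) (hR 0) hQ (hS 0) (hL 0) (hv 0) hΦ0
  have hflow := fun k => flowMoment_eq (δ k) (hR k) hQ (hv k) (2 * k + 1) (hΦ k)
  have hW := PsiDO.one_sub_dressing_orderLE (d := δ 0) (c 0)
  obtain ⟨X, hXW, hWX, hX⟩ := PsiDO.isUnit_of_order_sub_one hW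
  have hSato := fun k => PsiDO.exists_sato c (δ k) (2 * k + 1) hrec (hflow k)
  set P := PsiDO.dressing (c 0) * PsiDO.del 1 * X with hP
  have hPdel : ∀ i, -1 < i → P.coeff i = (Pi.single 1 1 : ℤ → A) i := fun i hi =>
    sub_eq_zero.1 (PsiDO.lax_sub_del_orderLE hW hWX hX i hi)
  refine ⟨P.coeff, by rw [hPdel _ (by norm_num), Pi.single_eq_same],
    by rw [hPdel _ (by norm_num), Pi.single_eq_of_ne (by norm_num)],
    fun i hi => by rw [hPdel _ (by omega), Pi.single_eq_of_ne hi.ne'], fun i => ?_,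
    fun k i => ?_, fun k => ?_⟩
  · have hadj : P + PsiDO.adj P = 0 := by
      refine PsiDO.lax_add_adj_eq_zero hXW hWX ?_
      rw [hc0]
      exact PsiDO.adj_dressing_mul_dressing_const (hR 0) (hS 0) (hL 0) (hv 0) hRL hQ hΦ0 hsymm
    exact congrArg (fun Y => PsiDO.coeff Y i) hadj
  · obtain ⟨B, hB, hBW⟩ := hSato k
    rw [← PsiDO.coeff_pow]
    exact congrArg (fun Y => PsiDO.coeff Y i)
      (PsiDO.deriv_lax hW hXW hWX hX (δ k) (2 * k + 1) hB hBW (hcomm k))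
  · obtain ⟨B, hB, hBW⟩ := hSato k
    rw [← PsiDO.coeff_pow, psiRes, PsiDO.res_lax_pow hW hXW hWX hX (δ k) (2 * k + 1) hB hBW]
    -- The residue is `-δ` of the coefficient `-c 0 0` of `∂⁻¹` in `W`, and `c 0 0 = vᵀΦv`.
    have := PsiDO.dressing_coeff_neg (d := δ 0) (c 0) 0
    rw [Nat.cast_zero, zero_add] at this
    rw [this, map_neg, neg_neg, congrFun hc0 0, pow_zero, mul_one]

end CKPLax

/-! ### Symmetry and commutativity of the Riccati flows. -/

section Hamiltonian

variable {A : Type*} [CommRing A] {n : Type*} [Fintype n] [DecidableEq n]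
  {R Q S L : Matrix n n A}

/-- Odd powers of a Hamiltonian block matrix are Hamiltonian. -/
theorem fromBlocks_pow_hamiltonian (hRL : R = -Lᵀ) (hS : Sᵀ = S) (hQ : Qᵀ = Q) {k : ℕ}
    (hk : Odd k) :
    (fromBlocks R Q S L ^ k).toBlocks₂₁ᵀ = (fromBlocks R Q S L ^ k).toBlocks₂₁ ∧
      (fromBlocks R Q S L ^ k).toBlocks₁₂ᵀ = (fromBlocks R Q S L ^ k).toBlocks₁₂ ∧
      (fromBlocks R Q S L ^ k).toBlocks₁₁ᵀ = -(fromBlocks R Q S L ^ k).toBlocks₂₂ := by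
  have hR' : Rᵀ = -L := by rw [hRL, transpose_neg, transpose_transpose]
  have hL' : Lᵀ = -R := by rw [hRL, neg_neg]
  have h1 : SemiconjBy (fromBlocks 0 1 (-1) 0 : Matrix (n ⊕ n) (n ⊕ n) A)
      (-fromBlocks R Q S L) (fromBlocks R Q S L)ᵀ := by
    rw [SemiconjBy, fromBlocks_transpose, fromBlocks_neg, fromBlocks_multiply,
      fromBlocks_multiply, hS, hQ, hR', hL']
    simp
  -- With `J = (0 1; -1 0)` one has `J(-H) = HᵀJ`, hence `J(-H)ᵏ = (Hᵏ)ᵀJ`; the sign survives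
  -- because `k` is odd.
  have h2 := (h1.pow_right k).eq
  rw [hk.neg_pow, ← transpose_pow] at h2
  rw [← fromBlocks_toBlocks (fromBlocks R Q S L ^ k), fromBlocks_transpose, fromBlocks_neg,
    fromBlocks_multiply, fromBlocks_multiply, fromBlocks_inj] at h2
  simp only [zero_mul, mul_zero, one_mul, mul_one, neg_mul, mul_neg, zero_add, add_zero,
    neg_neg, neg_zero, neg_inj] at h2
  exact ⟨h2.1.symm, h2.2.2.2.symm, h2.2.1.symm⟩

/-- Transposition exchanges the two linear terms and fixes the constant and the quadratic one, so
odd flows are tangent to the symmetric matrices. -/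
theorem riccati_symm (hRL : R = -Lᵀ) (hS : Sᵀ = S) (hQ : Qᵀ = Q) {Φ : Matrix n n A}
    (hΦ : Φᵀ = Φ) {k : ℕ} (hk : Odd k) :
    (lowerFlow R Q S L Φ k - Φ * upperFlow R Q S L Φ k)ᵀ =
      lowerFlow R Q S L Φ k - Φ * upperFlow R Q S L Φ k := by
  obtain ⟨h1, h2, h3⟩ := fromBlocks_pow_hamiltonian hRL hS hQ hk
  have h4 : (fromBlocks R Q S L ^ k).toBlocks₂₂ᵀ = -(fromBlocks R Q S L ^ k).toBlocks₁₁ := by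
    rw [← neg_eq_iff_eq_neg.2 h3, transpose_neg, transpose_transpose]
  simp only [lowerFlow, upperFlow, transpose_sub, transpose_add, transpose_mul, h1, h2, h3, h4, hΦ]
  noncomm_ring

end Hamiltonian

section Commuting

variable {A : Type*} [CommRing A] {n : Type*} [Fintype n] [DecidableEq n]
  {R Q S L Φ : Matrix n n A}

theorem upperFlow_add (i j : ℕ) : upperFlow R Q S L Φ (i + j) =
    (fromBlocks R Q S L ^ i).toBlocks₁₁ * upperFlow R Q S L Φ j +
      (fromBlocks R Q S L ^ i).toBlocks₁₂ * lowerFlow R Q S L Φ j := by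
  simp only [upperFlow, lowerFlow]
  rw [pow_add]
  conv_lhs => rw [← fromBlocks_toBlocks (fromBlocks R Q S L ^ i),
    ← fromBlocks_toBlocks (fromBlocks R Q S L ^ j), fromBlocks_multiply,
    toBlocks_fromBlocks₁₁, toBlocks_fromBlocks₁₂]
  noncomm_ring

theorem lowerFlow_add (i j : ℕ) : lowerFlow R Q S L Φ (i + j) =
    (fromBlocks R Q S L ^ i).toBlocks₂₁ * upperFlow R Q S L Φ j +
      (fromBlocks R Q S L ^ i).toBlocks₂₂ * lowerFlow R Q S L Φ j := by
  simp only [upperFlow, lowerFlow]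
  rw [pow_add]
  conv_lhs => rw [← fromBlocks_toBlocks (fromBlocks R Q S L ^ i),
    ← fromBlocks_toBlocks (fromBlocks R Q S L ^ j), fromBlocks_multiply,
    toBlocks_fromBlocks₂₁, toBlocks_fromBlocks₂₂]
  noncomm_ring

/-- A Riccati flow applied to the right hand side of another one. -/
theorem riccati_map_derivation (δ : Derivation ℤ A A) (hR : R.map δ = 0) (hQ : Q.map δ = 0)
    (hS : S.map δ = 0) (hL : L.map δ = 0) {i : ℕ}
    (hΦ : Φ.map δ = lowerFlow R Q S L Φ i - Φ * upperFlow R Q S L Φ i) (j : ℕ) :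
    (lowerFlow R Q S L Φ j - Φ * upperFlow R Q S L Φ j).map δ =
      lowerFlow R Q S L Φ (j + i) - Φ * upperFlow R Q S L Φ (j + i) -
        (lowerFlow R Q S L Φ j * upperFlow R Q S L Φ i +
          lowerFlow R Q S L Φ i * upperFlow R Q S L Φ j) +
        Φ * (upperFlow R Q S L Φ j * upperFlow R Q S L Φ i +
          upperFlow R Q S L Φ i * upperFlow R Q S L Φ j) := by
  have h := fromBlocks_pow_map_derivation δ hR hQ hS hL j
  have h11 : (fromBlocks R Q S L ^ j).toBlocks₁₁.map δ = 0 := by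
    ext a b; exact congrFun (congrFun h (Sum.inl a)) (Sum.inl b)
  have h12 : (fromBlocks R Q S L ^ j).toBlocks₁₂.map δ = 0 := by
    ext a b; exact congrFun (congrFun h (Sum.inl a)) (Sum.inr b)
  have h21 : (fromBlocks R Q S L ^ j).toBlocks₂₁.map δ = 0 := by
    ext a b; exact congrFun (congrFun h (Sum.inr a)) (Sum.inl b)
  have h22 : (fromBlocks R Q S L ^ j).toBlocks₂₂.map δ = 0 := by
    ext a b; exact congrFun (congrFun h (Sum.inr a)) (Sum.inr b)
  -- Lower block of `δ(Hʲ(1; Φ)) = Hʲ((uᵢ; gᵢ) - (1; Φ)uᵢ) = Hʲ⁺ⁱ(1; Φ) - Hʲ(1; Φ)uᵢ`; `hu` is the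
  -- upper block.
  have hl : (lowerFlow R Q S L Φ j).map δ =
      lowerFlow R Q S L Φ (j + i) - lowerFlow R Q S L Φ j * upperFlow R Q S L Φ i := by
    rw [lowerFlow_add]
    conv_lhs => rw [lowerFlow, Matrix.map_add _ (map_add δ), h21, Matrix.map_derivation_mul, h22,
      hΦ]
    conv_rhs => rw [lowerFlow.eq_def R Q S L Φ j]
    noncomm_ring
  have hu : (upperFlow R Q S L Φ j).map δ =
      upperFlow R Q S L Φ (j + i) - upperFlow R Q S L Φ j * upperFlow R Q S L Φ i := by
    rw [upperFlow_add]
    conv_lhs => rw [upperFlow, Matrix.map_add _ (map_add δ), h11, Matrix.map_derivation_mul, h12,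
      hΦ]
    conv_rhs => rw [upperFlow.eq_def R Q S L Φ j]
    noncomm_ring
  rw [Matrix.map_sub _ (map_sub δ), Matrix.map_derivation_mul, hl, hu, hΦ]
  noncomm_ring

/-- The second derivative found above is symmetric in `i` and `j`: it involves only `H^{i+j}` and
symmetrized products. -/
theorem riccati_flows_commute (δ δ' : Derivation ℤ A A) (hR : R.map δ = 0) (hQ : Q.map δ = 0)
    (hS : S.map δ = 0) (hL : L.map δ = 0) (hR' : R.map δ' = 0) (hQ' : Q.map δ' = 0)
    (hS' : S.map δ' = 0) (hL' : L.map δ' = 0) {i j : ℕ}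
    (hΦ : Φ.map δ = lowerFlow R Q S L Φ i - Φ * upperFlow R Q S L Φ i)
    (hΦ' : Φ.map δ' = lowerFlow R Q S L Φ j - Φ * upperFlow R Q S L Φ j) :
    (Φ.map δ').map δ = (Φ.map δ).map δ' := by
  rw [hΦ', riccati_map_derivation δ hR hQ hS hL hΦ, hΦ,
    riccati_map_derivation δ' hR' hQ' hS' hL' hΦ', add_comm j i,
    add_comm (lowerFlow R Q S L Φ j * _), add_comm (upperFlow R Q S L Φ j * _)]

end Commuting

theorem Sym2.apply_out_eq {n B : Type*} {M : Matrix n n B} (hM : Mᵀ = M) (i j : n) :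
    M (Quot.out s(i, j)).1 (Quot.out s(i, j)).2 = M i j := by
  have h : s((Quot.out s(i, j)).1, (Quot.out s(i, j)).2) = s(i, j) := Quot.out_eq s(i, j)
  rw [Sym2.eq_iff] at h
  rcases h with ⟨h1, h2⟩ | ⟨h1, h2⟩
  · rw [h1, h2]
  · rw [h1, h2, ← hM, transpose_apply, hM]

/-! ### The universal symmetric solution in a polynomial ring. -/

section SymmetricMatrixRing

variable {K : Type*} [Field K] {n : Type*}

/-- The generic symmetric matrix. -/
noncomputable def genericSymm (K n : Type*) [Field K] : Matrix n n (MvPolynomial (Sym2 n) K) :=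
  Matrix.of fun i j => MvPolynomial.X s(i, j)

theorem genericSymm_transpose : (genericSymm K n)ᵀ = genericSymm K n := by
  ext1 i j
  exact congrArg MvPolynomial.X Sym2.eq_swap

/-- A constant matrix over the polynomial ring. -/
noncomputable def constMatrix (M : Matrix n n K) : Matrix n n (MvPolynomial (Sym2 n) K) :=
  M.map MvPolynomial.C

theorem constMatrix_map_derivation (M : Matrix n n K)
    (δ : Derivation K (MvPolynomial (Sym2 n) K) (MvPolynomial (Sym2 n) K)) :
    (constMatrix M).map δ = 0 := by
  ext1 i j
  exact MvPolynomial.derivation_C δ (M i j)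

variable [Fintype n] [DecidableEq n] (R Q S L : Matrix n n K)

/-- The right hand side of the `k`-th Riccati equation at the generic symmetric matrix. -/
noncomputable def riccatiField (k : ℕ) : Matrix n n (MvPolynomial (Sym2 n) K) :=
  lowerFlow (constMatrix R) (constMatrix Q) (constMatrix S) (constMatrix L) (genericSymm K n) k -
    genericSymm K n *
      upperFlow (constMatrix R) (constMatrix Q) (constMatrix S) (constMatrix L) (genericSymm K n) k

/-- The Riccati flow as a derivation of the coordinate ring of the symmetric matrices. -/
noncomputable def riccatiDerivation (k : ℕ) :
    Derivation K (MvPolynomial (Sym2 n) K) (MvPolynomial (Sym2 n) K) :=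
  MvPolynomial.mkDerivation K fun s =>
    riccatiField R Q S L k (Quot.out s).1 (Quot.out s).2

theorem riccatiDerivation_X (k : ℕ) (s : Sym2 n) :
    riccatiDerivation R Q S L k (MvPolynomial.X s) =
      riccatiField R Q S L k (Quot.out s).1 (Quot.out s).2 :=
  MvPolynomial.mkDerivation_X _ _ _

variable {R Q S L}

theorem riccatiField_transpose (hRL : R = -Lᵀ) (hS : Sᵀ = S) (hQ : Qᵀ = Q) {k : ℕ} (hk : Odd k) :
    (riccatiField R Q S L k)ᵀ = riccatiField R Q S L k := by
  refine riccati_symm ?_ ?_ ?_ genericSymm_transpose hk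
  · rw [hRL]; ext1 i j; simp [constMatrix]
  · rw [constMatrix, ← transpose_map, hS]
  · rw [constMatrix, ← transpose_map, hQ]

/-- The derivation is prescribed on one representative of each unordered pair; symmetry of the field
gives both entries. -/
theorem genericSymm_map_riccatiDerivation (hRL : R = -Lᵀ) (hS : Sᵀ = S) (hQ : Qᵀ = Q) {k : ℕ}
    (hk : Odd k) :
    (genericSymm K n).map (riccatiDerivation R Q S L k) = riccatiField R Q S L k := by
  ext1 i j
  exact (riccatiDerivation_X R Q S L k s(i, j)).trans
    (Sym2.apply_out_eq (riccatiField_transpose hRL hS hQ hk) i j)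

/-- The commutator is again a derivation, so it suffices that it vanishes on the generators, the
entries of the generic matrix. -/
theorem riccatiDerivation_comm (hRL : R = -Lᵀ) (hS : Sᵀ = S) (hQ : Qᵀ = Q) {k l : ℕ}
    (hk : Odd k) (hl : Odd l) (p : MvPolynomial (Sym2 n) K) :
    riccatiDerivation R Q S L k (riccatiDerivation R Q S L l p) =
      riccatiDerivation R Q S L l (riccatiDerivation R Q S L k p) := by
  have h : ⁅riccatiDerivation R Q S L k, riccatiDerivation R Q S L l⁆ = 0 := by
    refine MvPolynomial.derivation_ext fun s => ?_
    induction s using Sym2.ind with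
    | _ i j =>
      have hc := fun (M : Matrix n n K) (m : ℕ) =>
        constMatrix_map_derivation M (riccatiDerivation R Q S L m)
      have := riccati_flows_commute
        ((riccatiDerivation R Q S L k).restrictScalars ℤ)
        ((riccatiDerivation R Q S L l).restrictScalars ℤ) (hc R k) (hc Q k) (hc S k) (hc L k)
        (hc R l) (hc Q l) (hc S l) (hc L l)
        (genericSymm_map_riccatiDerivation hRL hS hQ hk)
        (genericSymm_map_riccatiDerivation hRL hS hQ hl)
      rw [Derivation.commutator_apply, Derivation.zero_apply, sub_eq_zero]
      exact congrFun (congrFun this i) j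
  have := congrArg (fun D => D p) h
  rwa [Derivation.commutator_apply, Derivation.zero_apply, sub_eq_zero] at this

theorem exists_ckp_laxOperator_genericSymm {V : n → K} (hRL : R = -Lᵀ) (hS : Sᵀ = S)
    (hQ : Q = vecMulVec V V) :
    ∃ p : ℤ → MvPolynomial (Sym2 n) K, p 1 = 1 ∧ p 0 = 0 ∧ PsiOrderLE 1 p ∧
      (∀ i, p i + psiAdjoint (riccatiDerivation R Q S L 1) p i = 0) ∧
      (∀ k i, riccatiDerivation R Q S L (2 * k + 1) (p i) =
        psiMul (riccatiDerivation R Q S L 1)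
          (psiNonneg (psiPow (riccatiDerivation R Q S L 1) p (2 * k + 1))) p i -
        psiMul (riccatiDerivation R Q S L 1) p
          (psiNonneg (psiPow (riccatiDerivation R Q S L 1) p (2 * k + 1))) i) ∧
      ∀ k, psiRes (psiPow (riccatiDerivation R Q S L 1) p (2 * k + 1)) =
        riccatiDerivation R Q S L (2 * k + 1)
          (sandwich (fun i => MvPolynomial.C (V i)) (genericSymm K n)) := by
  have hQ' : Qᵀ = Q := by
    rw [hQ]; ext i j; simp [vecMulVec_apply, mul_comm]
  have hconst := fun (M : Matrix n n K) (k : ℕ) =>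
    constMatrix_map_derivation M (riccatiDerivation R Q S L (2 * k + 1))
  exact exists_ckp_laxOperator
    (R := constMatrix R) (Q := constMatrix Q) (S := constMatrix S) (L := constMatrix L)
    (fun k => (riccatiDerivation R Q S L (2 * k + 1)).restrictScalars ℤ)
    (fun k p => riccatiDerivation_comm hRL hS hQ' (odd_two_mul_add_one k)
      (odd_two_mul_add_one 0) p) (hconst R) (hconst S) (hconst L)
    (fun k i => MvPolynomial.derivation_C _ _)
    (by rw [hRL]; ext1 i j; simp [constMatrix])
    (by rw [hQ]; ext1 i j; simp [constMatrix, vecMulVec_apply])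
    (fun k => genericSymm_map_riccatiDerivation hRL hS hQ' (odd_two_mul_add_one k))
    genericSymm_transpose

end SymmetricMatrixRing

/-! ### Transfer from polynomials to functions on `D`. -/

section PsiSums

variable {B : Type*} [CommRing B] {d : B → B}

/-- Only `d 0 = 0` is assumed, because `timeDeriv` is not additive on arbitrary functions. The index
set depends on the orders alone, so the same finite sum serves for polynomials and for functions. -/
theorem psiMul_eq_sum (hd : d 0 = 0) {a b : ℤ} {P Q : ℤ → B} (hP : PsiOrderLE a P)
    (hQ : PsiOrderLE b Q) (n : ℤ) :
    psiMul d P Q n = ∑ p ∈ (finite_mul_index n a b).toFinset,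
      Ring.choose p.1 p.2 • (P p.1 * d^[p.2] (Q (n - p.1 + p.2))) := by
  refine finsum_eq_sum_of_support_subset _ fun p hp => ?_
  rw [Set.Finite.coe_toFinset]
  constructor
  · refine hP.le_of_ne_zero fun h => hp ?_
    simp only [h, zero_mul, smul_zero]
  · refine hQ.le_of_ne_zero fun h => hp ?_
    simp only [h, Function.iterate_fixed hd, mul_zero, smul_zero]

theorem PsiOrderLE.psiMul_of_map_zero (hd : d 0 = 0) {a b : ℤ} {P Q : ℤ → B}
    (hP : PsiOrderLE a P) (hQ : PsiOrderLE b Q) : PsiOrderLE (a + b) (_root_.psiMul d P Q) := by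
  intro n hn
  rw [psiMul_eq_sum hd hP hQ]
  refine Finset.sum_eq_zero fun p hp => ?_
  rw [Set.Finite.mem_toFinset, Set.mem_ofPred_eq] at hp
  omega

theorem psiOne_orderLE : PsiOrderLE 0 (psiOne : ℤ → B) := fun _ hi => if_neg hi.ne'

theorem PsiOrderLE.psiPow_of_map_zero (hd : d 0 = 0) {a : ℤ} {P : ℤ → B}
    (hP : PsiOrderLE a P) (k : ℕ) : PsiOrderLE (k * a) (psiPow d P k) := by
  induction k with
  | zero =>
    rw [Nat.cast_zero, zero_mul]
    exact psiOne_orderLE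
  | succ k ih =>
    rw [Nat.cast_succ, add_mul, one_mul]
    exact ih.psiMul_of_map_zero hd hP

theorem PsiOrderLE.psiNonneg {a : ℤ} {P : ℤ → B} (hP : PsiOrderLE a P) :
    PsiOrderLE a (psiNonneg P) := fun i hi => by rw [_root_.psiNonneg, hP i hi, ite_self]

theorem psiAdjoint_eq_sum (hd : d 0 = 0) {a : ℤ} {P : ℤ → B} (hP : PsiOrderLE a P) (n : ℤ) :
    psiAdjoint d P n = ∑ k ∈ Finset.range (a - n).toNat.succ,
      (((n + k).negOnePow : ℤ) * Ring.choose (n + k) k) • d^[k] (P (n + k)) := by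
  refine finsum_eq_sum_of_support_subset _ fun k hk => ?_
  have h : P (n + k) ≠ 0 := fun h0 => hk (by
    simp only [h0, Function.iterate_fixed hd, smul_zero])
  have := hP.le_of_ne_zero h
  rw [Finset.coe_range, Set.mem_Iio]
  omega

end PsiSums

section Represents

variable {T K A : Type*} [CommRing K] [CommRing A] (D : Set T) (ev : T → A →+* K)

/-- On `D` the function `f` is given by the element `p` of the coefficient ring. -/
def Represents (f : T → K) (p : A) : Prop := ∀ t ∈ D, f t = ev t p

variable {D ev} {δ : A → A} {d : (T → K) → T → K}

theorem Represents.mul {f g : T → K} {p q : A} (hf : Represents D ev f p)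
    (hg : Represents D ev g q) : Represents D ev (f * g) (p * q) := fun t ht => by
  rw [Pi.mul_apply, hf t ht, hg t ht, map_mul]

theorem Represents.zsmul {f : T → K} {p : A} (hf : Represents D ev f p) (c : ℤ) :
    Represents D ev (c • f) (c • p) := fun t ht => by
  rw [Pi.smul_apply, hf t ht, map_zsmul]

theorem Represents.sum {ι : Type*} {s : Finset ι} {f : ι → T → K} {p : ι → A}
    (h : ∀ i ∈ s, Represents D ev (f i) (p i)) :
    Represents D ev (∑ i ∈ s, f i) (∑ i ∈ s, p i) := fun t ht => by
  rw [Finset.sum_apply, map_sum]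
  exact Finset.sum_congr rfl fun i hi => h i hi t ht

theorem Represents.iterate (hdδ : ∀ f p, Represents D ev f p → Represents D ev (d f) (δ p))
    {f : T → K} {p : A} (hf : Represents D ev f p) (k : ℕ) :
    Represents D ev (d^[k] f) (δ^[k] p) := by
  induction k with
  | zero => exact hf
  | succ k ih =>
    rw [Function.iterate_succ_apply', Function.iterate_succ_apply']
    exact hdδ _ _ ih

variable (hdδ : ∀ f p, Represents D ev f p → Represents D ev (d f) (δ p)) (hd : d 0 = 0)
  (hδ : δ 0 = 0) {a b : ℤ} {P Q : ℤ → T → K} {p q : ℤ → A}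
include hdδ hd hδ

theorem Represents.psiMul (hP : PsiOrderLE a P) (hQ : PsiOrderLE b Q) (hp : PsiOrderLE a p)
    (hq : PsiOrderLE b q) (hPp : ∀ i, Represents D ev (P i) (p i))
    (hQq : ∀ i, Represents D ev (Q i) (q i)) (n : ℤ) :
    Represents D ev (psiMul d P Q n) (psiMul δ p q n) := by
  rw [psiMul_eq_sum hd hP hQ, psiMul_eq_sum hδ hp hq]
  exact Represents.sum fun x _ => ((hPp _).mul ((hQq _).iterate hdδ _)).zsmul _

theorem Represents.psiPow (hP : PsiOrderLE a P) (hp : PsiOrderLE a p)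
    (hPp : ∀ i, Represents D ev (P i) (p i)) (k : ℕ) :
    ∀ n, Represents D ev (psiPow d P k n) (psiPow δ p k n) := by
  induction k with
  | zero =>
    intro n t _
    change (psiOne n : T → K) t = ev t (psiOne n)
    rw [psiOne, psiOne]
    split_ifs <;> simp
  | succ k ih =>
    exact Represents.psiMul hdδ hd hδ (hP.psiPow_of_map_zero hd k) hP
      (hp.psiPow_of_map_zero hδ k) hp ih hPp

theorem Represents.psiAdjoint (hP : PsiOrderLE a P) (hp : PsiOrderLE a p)
    (hPp : ∀ i, Represents D ev (P i) (p i)) (n : ℤ) :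
    Represents D ev (psiAdjoint d P n) (psiAdjoint δ p n) := by
  rw [psiAdjoint_eq_sum hd hP, psiAdjoint_eq_sum hδ hp]
  exact Represents.sum fun k _ => ((hPp _).iterate hdδ _).zsmul _

end Represents

theorem Represents.psiNonneg {T K A : Type*} [CommRing K] [CommRing A] {D : Set T}
    {ev : T → A →+* K} {P : ℤ → T → K} {p : ℤ → A}
    (hPp : ∀ i, Represents D ev (P i) (p i)) (n : ℤ) :
    Represents D ev (psiNonneg P n) (psiNonneg p n) := by
  rw [_root_.psiNonneg, _root_.psiNonneg]
  split_ifs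
  · exact hPp n
  · intro t _; simp

section Evaluation

variable {T K : Type*} [Field K] {n : Type*}

/-- Evaluation of a polynomial in the entries of a symmetric matrix. -/
noncomputable def symmEval (Φ : T → Matrix n n K) (t : T) : MvPolynomial (Sym2 n) K →+* K :=
  MvPolynomial.eval fun s => Φ t (Quot.out s).1 (Quot.out s).2

theorem symmEval_C (Φ : T → Matrix n n K) (t : T) (a : K) :
    symmEval Φ t (MvPolynomial.C a) = a := MvPolynomial.eval_C a

theorem symmEval_X (Φ : T → Matrix n n K) (t : T) (s : Sym2 n) :
    symmEval Φ t (MvPolynomial.X s) = Φ t (Quot.out s).1 (Quot.out s).2 := MvPolynomial.eval_X s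

theorem genericSymm_map_symmEval {Φ : T → Matrix n n K} {t : T} (ht : (Φ t)ᵀ = Φ t) :
    (genericSymm K n).map (symmEval Φ t) = Φ t := by
  ext1 i j
  exact (symmEval_X Φ t s(i, j)).trans (Sym2.apply_out_eq ht i j)

theorem constMatrix_map_symmEval (Φ : T → Matrix n n K) (t : T) (M : Matrix n n K) :
    (constMatrix M).map (symmEval Φ t) = M := by
  ext1 i j
  exact symmEval_C Φ t (M i j)

variable [Fintype n] [DecidableEq n] {R Q S L : Matrix n n K}

theorem riccatiField_map_symmEval {Φ : T → Matrix n n K} {t : T} (ht : (Φ t)ᵀ = Φ t) (k : ℕ) :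
    (riccatiField R Q S L k).map (symmEval Φ t) =
      (fromBlocks R Q S L ^ k).toBlocks₂₁ + (fromBlocks R Q S L ^ k).toBlocks₂₂ * Φ t -
        Φ t * (fromBlocks R Q S L ^ k).toBlocks₁₁ -
          Φ t * (fromBlocks R Q S L ^ k).toBlocks₁₂ * Φ t := by
  have hH : (fromBlocks (constMatrix R) (constMatrix Q) (constMatrix S) (constMatrix L) ^ k).map
      (symmEval Φ t) = fromBlocks R Q S L ^ k := by
    rw [Matrix.map_pow, fromBlocks_map]
    simp only [constMatrix_map_symmEval]
  have h11 := congrArg toBlocks₁₁ hH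
  have h12 := congrArg toBlocks₁₂ hH
  have h21 := congrArg toBlocks₂₁ hH
  have h22 := congrArg toBlocks₂₂ hH
  simp only [riccatiField, lowerFlow, upperFlow, Matrix.map_sub _ (map_sub (symmEval Φ t)),
    Matrix.map_add _ (map_add (symmEval Φ t)), Matrix.map_mul, genericSymm_map_symmEval ht]
  rw [← h11, ← h12, ← h21, ← h22]
  change _ + _ * Φ t - Φ t * (_ + _ * Φ t) = _
  rw [mul_add, sub_add_eq_sub_sub, mul_assoc]
  rfl

end Evaluation

section TimeDerivatives

variable {𝕜 K : Type*} [RCLike 𝕜] [RCLike K] [NormedAlgebra 𝕜 K] {N : ℕ}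
  {R Q S L : Matrix (Fin N) (Fin N) K} {D : Set (ℕ → 𝕜)} {Φ : (ℕ → 𝕜) → Matrix (Fin N) (Fin N) K}

theorem timeDeriv_zero (k : ℕ) : timeDeriv k (0 : (ℕ → 𝕜) → K) = 0 := by
  funext t
  exact deriv_const _ _

/-- The chain rule, by induction on the polynomial: on the variables it is the Riccati equation, and
both sides obey the product rule. -/
theorem symmEval_hasDerivAt (hΦ : IsOddRiccatiSolution R Q S L D Φ)
    (hsymm : ∀ t ∈ D, (Φ t)ᵀ = Φ t) {t : ℕ → 𝕜} (ht : t ∈ D) (k : ℕ)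
    (p : MvPolynomial (Sym2 (Fin N)) K) :
    HasDerivAt (fun s : 𝕜 => symmEval Φ (Function.update t k s) p)
      (symmEval Φ t (riccatiDerivation R Q S L (2 * k + 1) p)) (t k) := by
  induction p using MvPolynomial.induction_on with
  | C a =>
    simp only [symmEval_C, riccatiDerivation, MvPolynomial.derivation_C, map_zero]
    exact hasDerivAt_const _ _
  | add p q hp hq =>
    simp only [map_add]
    exact hp.add hq
  | mul_X p x hp =>
    have hX : HasDerivAt (fun s : 𝕜 => symmEval Φ (Function.update t k s) (MvPolynomial.X x))
        (symmEval Φ t (riccatiDerivation R Q S L (2 * k + 1) (MvPolynomial.X x))) (t k) := by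
      simp only [symmEval_X]
      rw [riccatiDerivation_X]
      have h := hΦ t ht k (Quot.out x).1 (Quot.out x).2
      simp only at h
      rw [← riccatiField_map_symmEval (hsymm t ht)] at h
      exact h
    have h := hp.fun_mul hX
    simp only [Function.update_eq_self] at h
    simp only [map_mul, Derivation.leibniz, smul_eq_mul, map_add]
    rw [add_comm, mul_comm (symmEval Φ t (MvPolynomial.X x))]
    exact h

theorem Represents.hasDerivAt (hD : CoordOpen D) (hΦ : IsOddRiccatiSolution R Q S L D Φ)
    (hsymm : ∀ t ∈ D, (Φ t)ᵀ = Φ t) {f : (ℕ → 𝕜) → K} {p : MvPolynomial (Sym2 (Fin N)) K}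
    (hf : Represents D (symmEval Φ) f p) {t : ℕ → 𝕜} (ht : t ∈ D) (k : ℕ) :
    HasDerivAt (fun s : 𝕜 => f (Function.update t k s))
      (symmEval Φ t (riccatiDerivation R Q S L (2 * k + 1) p)) (t k) :=
  -- Openness along the axis makes `f` agree with the polynomial expression near `t k`, so values
  -- outside `D` do not matter.
  (symmEval_hasDerivAt hΦ hsymm ht k p).congr_of_eventuallyEq <|
    (hD t ht k).mono fun _ hs => hf _ hs

theorem Represents.timeDeriv (hD : CoordOpen D) (hΦ : IsOddRiccatiSolution R Q S L D Φ)
    (hsymm : ∀ t ∈ D, (Φ t)ᵀ = Φ t) {f : (ℕ → 𝕜) → K} {p : MvPolynomial (Sym2 (Fin N)) K}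
    (hf : Represents D (symmEval Φ) f p) (k : ℕ) :
    Represents D (symmEval Φ) (timeDeriv k f) (riccatiDerivation R Q S L (2 * k + 1) p) :=
  fun _ ht => (hf.hasDerivAt hD hΦ hsymm ht k).deriv

theorem Represents.iterTimeDeriv (hD : CoordOpen D) (hΦ : IsOddRiccatiSolution R Q S L D Φ)
    (hsymm : ∀ t ∈ D, (Φ t)ᵀ = Φ t) {f : (ℕ → 𝕜) → K} {p : MvPolynomial (Sym2 (Fin N)) K}
    (hf : Represents D (symmEval Φ) f p) (l : List ℕ) :
    Represents D (symmEval Φ) (iterTimeDeriv l f)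
      (l.foldr (fun k => riccatiDerivation R Q S L (2 * k + 1)) p) := by
  induction l with
  | nil => exact hf
  | cons k l ih => exact ih.timeDeriv hD hΦ hsymm k

theorem Represents.timeSmoothOn (hRL : R = -Lᵀ) (hS : Sᵀ = S) (hQ : Qᵀ = Q) (hD : CoordOpen D)
    (hΦ : IsOddRiccatiSolution R Q S L D Φ) (hsymm : ∀ t ∈ D, (Φ t)ᵀ = Φ t)
    {f : (ℕ → 𝕜) → K} {p : MvPolynomial (Sym2 (Fin N)) K}
    (hf : Represents D (symmEval Φ) f p) : TimeSmoothOn D f := by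
  refine ⟨fun l k t ht =>
    ((hf.iterTimeDeriv hD hΦ hsymm l).hasDerivAt hD hΦ hsymm ht k).differentiableAt,
    fun l l' hl t ht => ?_⟩
  -- Independence of the order of differentiation is commutativity of the derivations, passed
  -- through evaluation.
  have : LeftCommutative fun (k : ℕ) (q : MvPolynomial (Sym2 (Fin N)) K) =>
      riccatiDerivation R Q S L (2 * k + 1) q :=
    ⟨fun k m q => riccatiDerivation_comm hRL hS hQ (odd_two_mul_add_one k)
      (odd_two_mul_add_one m) q⟩
  rw [hf.iterTimeDeriv hD hΦ hsymm l t ht, hf.iterTimeDeriv hD hΦ hsymm l' t ht,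
    hl.foldr_eq]

end TimeDerivatives

theorem corollary5p1 {𝕜 K : Type*} [RCLike 𝕜] [RCLike K] [NormedAlgebra 𝕜 K] (N : ℕ)
    (L Q R S : Matrix (Fin N) (Fin N) K) (V : Fin N → K)
    (hR : R = -L.transpose) (hS : S = S.transpose) (hQ : Q = Matrix.vecMulVec V V)
    (D : Set (ℕ → 𝕜)) (hD : CoordOpen D)
    (Φ : (ℕ → 𝕜) → Matrix (Fin N) (Fin N) K)
    (hΦ : IsOddRiccatiSolution R Q S L D Φ)
    (hsymm : ∀ t ∈ D, (Φ t).transpose = Φ t) :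
    IsCKPSolution D (fun t => dotProduct V ((Φ t).mulVec V)) := by
  have hQ' : Q.transpose = Q := by
    rw [hQ]; ext i j; simp [Matrix.vecMulVec_apply, mul_comm]
  obtain ⟨p, hp1, hp0, hpord, hpadj, hplax, hpres⟩ :=
    exists_ckp_laxOperator_genericSymm hR hS.symm hQ
  have hdδ : ∀ k (f : (ℕ → 𝕜) → K) p, Represents D (symmEval Φ) f p →
      Represents D (symmEval Φ) (timeDeriv k f)
        (riccatiDerivation R Q S L (2 * k + 1) p) :=
    fun k f p hf => hf.timeDeriv hD hΦ hsymm k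
  have hsmooth : ∀ {f : (ℕ → 𝕜) → K} {p}, Represents D (symmEval Φ) f p → TimeSmoothOn D f :=
    fun hf => hf.timeSmoothOn hR hS.symm hQ' hD hΦ hsymm
  have hφ : Represents D (symmEval Φ) (fun t => dotProduct V ((Φ t).mulVec V))
      (sandwich (fun i => MvPolynomial.C (V i)) (genericSymm K (Fin N))) := fun t ht => by
    rw [sandwich_apply]
    simp only [dotProduct, mulVec, map_sum, map_mul, symmEval_C]
    conv_lhs => rw [← genericSymm_map_symmEval (hsymm t ht)]
    rfl
  -- The coefficient of `∂^{1-j}` is `u j`. The values at `j = 0, 1` never enter `laxOperator`,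
  -- where the coefficients `1` and `0` of `∂` and `∂⁰` agree with `hp1` and `hp0`.
  let u : ℕ → (ℕ → 𝕜) → K := fun j t => symmEval Φ t (p (1 - j))
  have huord : PsiOrderLE 1 (laxOperator u) := fun i hi => by
    rw [laxOperator, if_neg hi.ne', if_neg (by omega)]
  have hu : ∀ i, Represents D (symmEval Φ) (laxOperator u i) (p i) := fun i t _ => by
    rw [laxOperator]
    split_ifs with h1 h2
    · rw [h1, hp1, map_one]; rfl
    · change symmEval Φ t (p (1 - ((1 - i).toNat : ℤ))) = _
      rw [show 1 - ((1 - i).toNat : ℤ) = i by omega]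
    · have hpi : p i = 0 := by
        rcases (show 0 ≤ i by omega).eq_or_lt with rfl | h
        · exact hp0
        · exact hpord i (by omega)
      rw [hpi, map_zero]; rfl
  have hd0 : timeDeriv 0 (0 : (ℕ → 𝕜) → K) = 0 := timeDeriv_zero 0
  have hδ0 : riccatiDerivation R Q S L 1 0 = 0 := map_zero _
  have hpow := Represents.psiPow (hdδ 0) hd0 hδ0 huord hpord hu
  refine ⟨hsmooth hφ, u, fun j => hsmooth (p := p (1 - j)) fun _ _ => rfl,
    fun i t ht => ?_, fun k i t ht => ?_, fun k t ht => ?_⟩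
  · rw [hu i t ht, Represents.psiAdjoint (hdδ 0) hd0 hδ0 huord hpord hu i t ht, ← map_add]
    exact (congrArg _ (hpadj i)).trans (map_zero _)
  · have hB := Represents.psiNonneg (hpow (2 * k + 1))
    have hBord := (huord.psiPow_of_map_zero hd0 (2 * k + 1)).psiNonneg
    have hbord := (hpord.psiPow_of_map_zero hδ0 (2 * k + 1)).psiNonneg
    rw [hdδ k _ _ (hu i) t ht,
      Represents.psiMul (hdδ 0) hd0 hδ0 hBord huord hbord hpord hB hu i t ht,
      Represents.psiMul (hdδ 0) hd0 hδ0 huord hBord hpord hbord hu hB i t ht, ← map_sub]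
    exact congrArg _ (hplax k i)
  · rw [hdδ k _ _ hφ t ht, psiRes, hpow (2 * k + 1) (-1) t ht]
    exact congrArg _ (hpres k).symm
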